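/- Let $G$ be a finite simple graph that is co-chordal, i.e. its complement $\overline G$ is chordal (every cycle of length at least four has a chord), let $\Delta=\Delta_G$ be its independence complex (the faces are the independent sets of vertices), and let $\mathbb K$ be a field. For a simplicial complex $\Gamma$ write $\operatorname{mdim}\Gamma$ for the minimum of $|F|-1$ over the facets $F$ of $\Gamma$, and $\langle F\rangle$ for the simplex of all subsets of $F$. Then the following are equivalent: 1. $\Delta$ is weakly connected: any two facets $A,B$ can be joined by a sequence of facets $F_0=A,\dots,F_p=B$ with $|F_i\cap F_{i+1}|\ge \operatorname{mdim}\Delta$ for all $i$. 2. $\Delta$ is vertex dismissible, where recursively a complex $\Gamma$ is vertex dismissible if it is a simplex, or if it has a vertex $x$ with $\operatorname{mdim}\operatorname{del}_\Gamma(x)\ge\operatorname{mdim}\Gamma$ such that both the deletion $\operatorname{del}_\Gamma(x)=\{F\in\Gamma: x\notin F\}$ and the link $\operatorname{link}_\Gamma(x)=\{F\setminus\{x\}: x\in F\in\Gamma\}$ are vertex dismissible. 3. $\Delta$ is scalable: its facets admit an order $F_1,\dots,F_q$ such that $\operatorname{mdim}\bigl(\langle F_j\rangle\cap\bigcup_{i<j}\langle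 F_i\rangle\bigr)\ge\operatorname{mdim}\Delta-1$ for all $2\le j\le q$. 4. $\Delta$ is initially Cohen–Macaulay over $\mathbb K$: the subcomplex generated by all faces of $\Delta$ of dimension $\operatorname{mdim}\Delta$ is Cohen–Macaulay over $\mathbb K$, i.e. its Stanley–Reisner ring has depth equal to its Krull dimension. -/

import Mathlib

/-- A simplicial complex on the vertex set `V`: a collection of finite subsets of `V` closed under
inclusion. The empty set is a face of every complex except the void one (no faces at all). -/
@[ext]
structure SComplex (V : Type*) where
  /-- the faces -/
  faces : Set (Finset V)
  down_closed : ∀ ⦃F G : Finset V⦄, F ∈ faces → G ⊆ F → G ∈ faces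

namespace SComplex

variable {V : Type*}

/-- The facets of `Δ` are its inclusion-maximal faces. -/
def IsFacet (Δ : SComplex V) (F : Finset V) : Prop :=
  Maximal (fun A => A ∈ Δ.faces) F

/-- The dimension `|F| - 1` of a face. -/
def faceDim (F : Finset V) : ℤ := (F.card : ℤ) - 1

/-- The initial dimension: the least dimension of a facet. It is used only for complexes
which are not void, and then it is a minimum over a nonempty set when `V` is finite. -/
noncomputable def mdim (Δ : SComplex V) : ℤ :=
  ((sInf {n : ℕ | ∃ F, Δ.IsFacet F ∧ F.card = n} : ℕ) : ℤ) - 1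

/-- The subcomplex generated by a set `S` of faces, that is, the union of the full simplices
on the members of `S`. -/
def generatedBy (S : Set (Finset V)) : SComplex V where
  faces := {A | ∃ B ∈ S, A ⊆ B}
  down_closed := by
    rintro F G ⟨B, hB, hFB⟩ hGF
    exact ⟨B, hB, hGF.trans hFB⟩

/-- The simplex `⟨F⟩`, whose faces are all subsets of `F`. -/
def simplex (F : Finset V) : SComplex V := generatedBy {F}

/-- The intersection of two complexes. -/
def inter (Δ Γ : SComplex V) : SComplex V where
  faces := Δ.faces ∩ Γ.faces
  down_closed := fun _ _ hF hGF => ⟨Δ.down_closed hF.1 hGF, Γ.down_closed hF.2 hGF⟩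

/-- The deletion of `x`: all faces that do not contain `x`. -/
def deletion (Δ : SComplex V) (x : V) : SComplex V where
  faces := {F | F ∈ Δ.faces ∧ x ∉ F}
  down_closed := fun _ _ hF hGF => ⟨Δ.down_closed hF.1 hGF, fun hx => hF.2 (hGF hx)⟩

/-- The link of `x`: all sets `F \ {x}` with `F` a face containing `x`. -/
def link [DecidableEq V] (Δ : SComplex V) (x : V) : SComplex V where
  faces := {G | ∃ F ∈ Δ.faces, x ∈ F ∧ G = F.erase x}
  down_closed := by
    rintro _ G ⟨F, hF, hx, rfl⟩ hG
    have hxG : x ∉ G := fun h => Finset.notMem_erase x F (hG h)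
    refine ⟨insert x G, Δ.down_closed hF ?_, Finset.mem_insert_self x G,
      (Finset.erase_insert hxG).symm⟩
    exact Finset.insert_subset hx (hG.trans (Finset.erase_subset x F))

/-- The pure `k`-skeleton: the subcomplex generated by all `k`-dimensional faces. -/
def pureSkeleton (Δ : SComplex V) (k : ℤ) : SComplex V :=
  generatedBy {F | F ∈ Δ.faces ∧ faceDim F = k}

/-- Any two facets are joined by a sequence of facets in which any two consecutive members
share at least `mdim Δ` vertices. -/
def WeaklyConnected [DecidableEq V] (Δ : SComplex V) : Prop :=
  ∀ A B, Δ.IsFacet A → Δ.IsFacet B →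
    Relation.ReflTransGen
      (fun F F' => Δ.IsFacet F ∧ Δ.IsFacet F' ∧ Δ.mdim ≤ ((F ∩ F').card : ℤ)) A B

/-- A vertex `x` of `Δ` is dismissing if its deletion has initial dimension at least `mdim Δ`. -/
def IsDismissing (Δ : SComplex V) (x : V) : Prop :=
  {x} ∈ Δ.faces ∧ Δ.mdim ≤ (Δ.deletion x).mdim

/-- A complex is vertex dismissible if it is a simplex (possibly `⟨∅⟩ = {∅}`), or if it has
a dismissing vertex whose deletion and link are both vertex dismissible. -/
inductive VertexDismissible [DecidableEq V] : SComplex V → Prop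
  | of_simplex (F : Finset V) : VertexDismissible (simplex F)
  | of_dismissing (Δ : SComplex V) (x : V) (hx : Δ.IsDismissing x)
      (hdel : VertexDismissible (Δ.deletion x)) (hlink : VertexDismissible (Δ.link x)) :
      VertexDismissible Δ

/-- A complex is scalable if its facets can be listed, without repetition, as `F 0, …, F (q - 1)`
so that for every `j > 0` the intersection of `⟨F j⟩` with the union of the earlier simplices
has initial dimension at least `mdim Δ - 1`. -/
def Scalable (Δ : SComplex V) : Prop :=
  ∃ (q : ℕ) (F : Fin q → Finset V), Function.Injective F ∧ (∀ A, Δ.IsFacet A ↔ ∃ i, F i = A) ∧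
    ∀ j : Fin q, 0 < (j : ℕ) →
      Δ.mdim - 1 ≤ ((simplex (F j)).inter (generatedBy {A | ∃ i, i < j ∧ F i = A})).mdim

section StanleyReisner

variable (K : Type*) [Field K]

/-- The Stanley–Reisner ideal, generated by the squarefree monomials of the non-faces. -/
noncomputable def stanleyReisnerIdeal (Δ : SComplex V) : Ideal (MvPolynomial V K) :=
  Ideal.span {f | ∃ F : Finset V, F ∉ Δ.faces ∧ f = ∏ v ∈ F, MvPolynomial.X v}

/-- The Stanley–Reisner ring `K[Δ]`. -/
abbrev StanleyReisnerRing (Δ : SComplex V) : Type _ :=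
  MvPolynomial V K ⧸ Δ.stanleyReisnerIdeal K

/-- The graded maximal ideal of `K[Δ]`, generated by the classes of the variables. -/
noncomputable def irrelevantIdeal (Δ : SComplex V) : Ideal (Δ.StanleyReisnerRing K) :=
  Ideal.span (Set.range fun v : V =>
    Ideal.Quotient.mk (Δ.stanleyReisnerIdeal K) (MvPolynomial.X v))

/-- The depth of the graded ring `K[Δ]`: the supremum of the lengths of the regular sequences
on `K[Δ]` that are contained in its graded maximal ideal. -/
noncomputable def depth (Δ : SComplex V) : ℕ∞ :=
  ⨆ (rs : List (Δ.StanleyReisnerRing K)) (_ : ∀ r ∈ rs, r ∈ Δ.irrelevantIdeal K)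
    (_ : RingTheory.Sequence.IsRegular (Δ.StanleyReisnerRing K) rs), (rs.length : ℕ∞)

/-- `Δ` is Cohen–Macaulay over `K`: the graded ring `K[Δ]` has depth equal to its
Krull dimension. -/
def IsCohenMacaulay (Δ : SComplex V) : Prop :=
  ((Δ.depth K : ℕ∞) : WithBot ℕ∞) = ringKrullDim (Δ.StanleyReisnerRing K)

/-- `Δ` is initially Cohen–Macaulay over `K`: its pure skeleton in dimension `mdim Δ` is
Cohen–Macaulay over `K`. -/
def IsInitiallyCohenMacaulay (Δ : SComplex V) : Prop :=
  (Δ.pureSkeleton Δ.mdim).IsCohenMacaulay K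

end StanleyReisner

end SComplex

namespace SimpleGraph

/-- A graph is chordal if every cycle of length at least four has a chord: an edge of the graph
between two vertices of the cycle which is not an edge of the cycle. -/
def ChordalGraph {V : Type*} (H : SimpleGraph V) : Prop :=
  ∀ (v : V) (c : H.Walk v v), c.IsCycle → 4 ≤ c.length →
    ∃ a ∈ c.support, ∃ b ∈ c.support, H.Adj a b ∧ s(a, b) ∉ c.edges

/-- A graph is co-chordal if its complement is chordal. -/
def CoChordal {V : Type*} (G : SimpleGraph V) : Prop := Gᶜ.ChordalGraph

/-- The independence complex: the faces are the finite independent sets of vertices. -/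
def indepComplex {V : Type*} (G : SimpleGraph V) : SComplex V where
  faces := {F | G.IsIndepSet (F : Set V)}
  down_closed := fun _ _ hF hGF => Set.Pairwise.mono (Finset.coe_subset.mpr hGF) hF

end SimpleGraph

/-! ### Depth of modules over a Noetherian local ring. -/

section LocalAlgebra

open RingTheory.Sequence IsLocalRing

universe u v

/-! Put `H = Gᶜ`, a chordal graph; the faces of the complex are the cliques of `H`. Conditions 2, 3
and 4 each imply weak connectedness for every complex on finitely many vertices, and chordality
serves only for the converses.

Scaling orders and vertex dismissals yield chains of facets directly. For condition 4, suppose two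
facets are not joined. Then the faces of dimension `mdim` split into two nonempty classes meeting in
codimension at least two. Let `a₁`, `a₂` be the sums of the monomials of the two classes. Then `a₁ +
a₂` is regular, the class of `a₁` modulo it is nonzero even locally at the irrelevant ideal, and
this class is killed by all squarefree monomials of degree one less than the facets. The quotient by
its annihilator is so small that the depth falls below the dimension (`length_lt_of_separated`).

For the converses, fix a smallest facet `C`. As long as vertices outside `C` remain, Dirac's theorem
supplies a simplicial vertex not adjacent to some member of `C`; weak connectedness and the
minimality of `C` survive its removal (`ChordalGraph.cliqueBuild`). Read backwards, `H` grows from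
`C` by vertices `v` attached to cliques `N` with `|N| ≥ |C| - 1`. Such a `v` is dismissing with a
simplex as link, `insert v N` fits into a scaling order, and the pure skeleton grows by a shelling.
A shelling makes the elementary symmetric polynomials a regular sequence
(`isWeaklyRegular_esymmList`), hence Cohen–Macaulayness. -/

theorem isSMulRegular_quotSMulTop_iff {A : Type*} [CommRing A] {M : Type*} [AddCommGroup M]
    [Module A M] {x z : A} :
    IsSMulRegular (QuotSMulTop x M) z ↔ ∀ m w : M, z • m = x • w → ∃ w', m = x • w' := by
  refine (isSMulRegular_quotient_iff_mem_of_smul_mem _ _).trans ?_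
  simp only [Submodule.mem_smul_pointwise_iff_exists, Submodule.mem_top, true_and]
  exact ⟨fun h m w hw => (h m ⟨w, hw.symm⟩).imp fun _ h => h.symm,
    fun h m ⟨w, hw⟩ => (h m w hw.symm).imp fun _ h => h.symm⟩

/-- If `x` and then `z` is regular, and `z` is regular, then `x` is regular modulo `z`. -/
theorem isSMulRegular_quotSMulTop_swap {A : Type*} [CommRing A] {M : Type*} [AddCommGroup M]
    [Module A M] {x z : A} (hx : IsSMulRegular M x) (hxz : IsSMulRegular (QuotSMulTop x M) z) :
    IsSMulRegular (QuotSMulTop z M) x := by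
  rw [isSMulRegular_quotSMulTop_iff] at hxz ⊢
  intro m w h
  obtain ⟨w', rfl⟩ := hxz w m h.symm
  exact ⟨w', hx (by simpa [smul_comm z x] using h)⟩

/-- Dividing by two elements in either order gives the same module. -/
def quotSMulTopComm {A : Type*} [CommRing A] (M : Type*) [AddCommGroup M]
    [Module A M] (x z : A) :
    QuotSMulTop z (QuotSMulTop x M) ≃ₗ[A] QuotSMulTop x (QuotSMulTop z M) :=
  let e (x z : A) := (Submodule.quotEquivOfEqBot _ (by simp)).symm ≪≫ₗ
    (Submodule.quotOfListConsSMulTopEquivQuotSMulTopInner (QuotSMulTop x M) z []).symm ≪≫ₗ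
    (Submodule.quotOfListConsSMulTopEquivQuotSMulTopInner M x [z]).symm
  e x z ≪≫ₗ Submodule.quotEquivOfEq _ _ (by
    simp only [Ideal.ofList_cons, Ideal.ofList_nil, sup_bot_eq]; rw [sup_comm]) ≪≫ₗ (e z x).symm

variable {A : Type u} [CommRing A] [IsLocalRing A]

/-- The module `M` has a weakly regular sequence of length `n` in the maximal ideal. -/
def DepthGE (n : ℕ) (M : Type v) [AddCommGroup M] [Module A M] : Prop :=
  ∃ rs : List A, rs.length = n ∧ (∀ r ∈ rs, r ∈ maximalIdeal A) ∧ IsWeaklyRegular M rs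

theorem depthGE_succ_iff {n : ℕ} {M : Type v} [AddCommGroup M] [Module A M] :
    DepthGE (A := A) (n + 1) M ↔
      ∃ x ∈ maximalIdeal A, IsSMulRegular M x ∧ DepthGE (A := A) n (QuotSMulTop x M) := by
  constructor
  · rintro ⟨_ | ⟨x, rs⟩, hl, hm, hr⟩
    · simp at hl
    · rw [isWeaklyRegular_cons_iff] at hr
      exact ⟨x, hm x (by simp), hr.1, rs, by simpa using hl, fun r h => hm r (by simp [h]), hr.2⟩
  · rintro ⟨x, hx, hr, rs, hl, hm, hrs⟩
    exact ⟨x :: rs, by simp [hl], by simpa using ⟨hx, hm⟩,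
      (isWeaklyRegular_cons_iff M x rs).2 ⟨hr, hrs⟩⟩

theorem DepthGE.of_equiv {n : ℕ} {M N : Type v} [AddCommGroup M] [Module A M]
    [AddCommGroup N] [Module A N] (e : M ≃ₗ[A] N) (h : DepthGE (A := A) n M) :
    DepthGE (A := A) n N := by
  obtain ⟨rs, hl, hm, hr⟩ := h
  exact ⟨rs, hl, hm, (e.isWeaklyRegular_congr rs).1 hr⟩

variable [IsNoetherianRing A]

/-- Prime avoidance: a maximal ideal of zero divisors lies in one of the finitely many associated
primes, so it kills the element whose annihilator that prime is. -/
theorem exists_isSMulRegular_of_forall_ne_zero (M : Type v) [AddCommGroup M] [Module A M]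
    [Module.Finite A M] (h : ∀ u : M, u ≠ 0 → ∃ r ∈ maximalIdeal A, r • u ≠ 0) :
    ∃ z ∈ maximalIdeal A, IsSMulRegular M z := by
  by_contra! hc
  have hsub : ((maximalIdeal A : Ideal A) : Set A) ⊆ ⋃ p ∈ associatedPrimes A M, p := by
    rw [biUnion_associatedPrimes_eq_compl_regular]
    exact fun r hr => hc r hr
  obtain ⟨p, hp, hle⟩ := (Ideal.subset_union_prime_finite (associatedPrimes.finite A M) ⊥ ⊥
    (fun I hI _ _ => hI.isPrime)).1 hsub
  have hp' := isAssociatedPrime_iff.1 hp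
  obtain ⟨hprime, u, hu⟩ := hp'
  have hu0 : u ≠ 0 := by
    rintro rfl
    apply hprime.ne_top
    rw [hu, Ideal.eq_top_iff_one, Submodule.mem_colon_singleton]
    simp
  obtain ⟨r, hr, hru⟩ := h u hu0
  apply hru
  have := hle hr
  rw [hu, Submodule.mem_colon_singleton] at this
  simpa using this

/-- Dividing by a regular element of the maximal ideal lowers the depth by at most one. -/
theorem DepthGE.quotSMulTop {n : ℕ} : ∀ {M : Type v} [AddCommGroup M] [Module A M]
    [Module.Finite A M], DepthGE (A := A) (n + 1) M → ∀ {a : A}, a ∈ maximalIdeal A →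
      IsSMulRegular M a → DepthGE (A := A) n (QuotSMulTop a M) := by
  induction n with
  | zero => exact fun _ _ _ _ => ⟨[], rfl, by simp, .nil _ _⟩
  | succ n ih =>
    intro M _ _ _ h a ha hreg
    obtain ⟨x, hx, hxr, hd⟩ := depthGE_succ_iff.1 h
    obtain ⟨y, hy, hyr, -⟩ := depthGE_succ_iff.1 hd
    -- A single `z` regular on `M`, `M/aM` and `M/xM` makes it possible to exchange `x` for `z` and
    -- then `z` for `a`. It exists once no nonzero element of the direct sum is killed by the
    -- maximal ideal.
    obtain ⟨z, hz, hzr⟩ := exists_isSMulRegular_of_forall_ne_zero (A := A)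
      (M × QuotSMulTop a M × QuotSMulTop x M) (by
        rintro ⟨u, v, w⟩ hne
        by_contra! hall
        have hu : u = 0 := hxr.right_eq_zero_of_smul (congrArg Prod.fst (hall x hx))
        have hw : w = 0 :=
          hyr.right_eq_zero_of_smul (congrArg (fun t => t.2.2) (hall y hy))
        have hv : ∀ r ∈ maximalIdeal A, r • v = 0 :=
          fun r hr => congrArg (fun t => t.2.1) (hall r hr)
        apply hne
        suffices v = 0 by rw [hu, hw, this]; rfl
        obtain ⟨v, rfl⟩ := Submodule.Quotient.mk_surjective _ v
        have hv' : ∀ r ∈ maximalIdeal A, ∃ t : M, a • t = r • v := by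
          intro r hr
          have := hv r hr
          rw [← Submodule.Quotient.mk_smul, Submodule.Quotient.mk_eq_zero,
            Submodule.mem_smul_pointwise_iff_exists] at this
          simpa using this
        -- From `x v = a t` and `y v = a s`, cancelling `a` gives `y t = x s`. As `y` is regular
        -- modulo `x`, `t = x t'`, and cancelling `x` gives `v = a t'`.
        obtain ⟨t, ht⟩ := hv' x hx
        obtain ⟨s, hs⟩ := hv' y hy
        rw [isSMulRegular_quotSMulTop_iff] at hyr
        obtain ⟨t', rfl⟩ := hyr t s (hreg (by
          simp only
          rw [smul_comm a y t, ht, smul_comm a x s, hs, smul_comm]))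
        rw [Submodule.Quotient.mk_eq_zero, Submodule.mem_smul_pointwise_iff_exists]
        exact ⟨t', trivial, hxr (by simpa [smul_comm x a] using ht)⟩)
    have hz1 : IsSMulRegular M z := fun p q h => by
      have := @hzr (p, 0, 0) (q, 0, 0) (by simpa using h)
      simpa using this
    have hz2 : IsSMulRegular (QuotSMulTop a M) z := fun p q h => by
      have := @hzr (0, p, 0) (0, q, 0) (by simpa using h)
      simpa using this
    have hz3 : IsSMulRegular (QuotSMulTop x M) z := fun p q h => by
      have := @hzr (0, 0, p) (0, 0, q) (by simpa using h)
      simpa using this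
    have h1 : DepthGE (A := A) (n + 1) (QuotSMulTop z M) := depthGE_succ_iff.2
      ⟨x, hx, isSMulRegular_quotSMulTop_swap hxr hz3,
        (ih hd hz hz3).of_equiv (quotSMulTopComm M x z)⟩
    exact depthGE_succ_iff.2 ⟨z, hz, hz2,
      (ih h1 ha (isSMulRegular_quotSMulTop_swap hreg hz2)).of_equiv (quotSMulTopComm M z a)⟩

/-- The depth of a module is at most the dimension of each nonzero cyclic submodule. -/
theorem DepthGE.le_ringKrullDim_quotient_torsionOf {n : ℕ} : ∀ {M : Type v} [AddCommGroup M]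
    [Module A M] [Module.Finite A M], DepthGE (A := A) n M → ∀ {u : M}, u ≠ 0 →
      (n : WithBot ℕ∞) ≤ ringKrullDim (A ⧸ Ideal.torsionOf A M u) := by
  induction n with
  | zero =>
    intro M _ _ _ _ u hu
    have : Nontrivial (A ⧸ Ideal.torsionOf A M u) := by
      rw [Ideal.Quotient.nontrivial_iff]
      exact fun h => hu ((Ideal.torsionOf_eq_top_iff A u).1 h)
    exact_mod_cast ringKrullDim_nonneg_of_nontrivial
  | succ n ih =>
    intro M _ _ _ h u hu
    obtain ⟨x, hx, hxr, hd⟩ := depthGE_succ_iff.1 h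
    -- By Krull's intersection theorem `u` is not divisible by every power of `x`. Dividing out the
    -- largest power keeps the annihilator and leaves `w` nonzero modulo `x`.
    obtain ⟨k, w, hw, hk⟩ : ∃ (k : ℕ) (w : M), x ^ k • w = u ∧ ∀ t, x • t ≠ w := by
      by_contra! hc
      have hall : ∀ k : ℕ, ∃ w, x ^ k • w = u := by
        intro k
        induction k with
        | zero => exact ⟨u, by simp⟩
        | succ k ihk =>
          obtain ⟨w, hw⟩ := ihk
          obtain ⟨t, ht⟩ := hc k w hw
          exact ⟨t, by rw [pow_succ, mul_smul, ht, hw]⟩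
      apply hu
      have hbot := Ideal.iInf_pow_smul_eq_bot_of_isLocalRing (M := M) (Ideal.span {x})
        (fun h => by
          have := (Ideal.span_singleton_eq_top.1 h)
          exact (mem_maximalIdeal x).1 hx this)
      rw [← Submodule.mem_bot A, ← hbot, Submodule.mem_iInf]
      intro k
      obtain ⟨w, hw⟩ := hall k
      rw [← hw]
      exact Submodule.smul_mem_smul (Ideal.pow_mem_pow (Ideal.mem_span_singleton_self x) k) trivial
    have hkr : IsSMulRegular M (x ^ k) := hxr.pow k
    have htors : ∀ r, r ∈ Ideal.torsionOf A M u ↔ r • w = 0 := by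
      intro r
      rw [Ideal.mem_torsionOf_iff, ← hw, smul_comm]
      exact ⟨fun h => hkr.right_eq_zero_of_smul h, fun h => by rw [h, smul_zero]⟩
    let w' : QuotSMulTop x M := Submodule.Quotient.mk w
    have hw' : w' ≠ 0 := by
      intro h0
      rw [Submodule.Quotient.mk_eq_zero, Submodule.mem_smul_pointwise_iff_exists] at h0
      obtain ⟨t, -, ht⟩ := h0
      exact hk t ht
    have hle : Ideal.torsionOf A M u ≤ Ideal.torsionOf A (QuotSMulTop x M) w' := by
      intro r hr
      rw [Ideal.mem_torsionOf_iff, ← Submodule.Quotient.mk_smul, (htors r).1 hr]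
      rfl
    have hx0 : x ∈ Ideal.torsionOf A (QuotSMulTop x M) w' := by
      rw [Ideal.mem_torsionOf_iff, ← Submodule.Quotient.mk_smul, Submodule.Quotient.mk_eq_zero]
      exact Submodule.smul_mem_pointwise_smul _ _ _ trivial
    -- The annihilator of `w` modulo `x` contains that of `u` together with `x`, and `x` is a
    -- nonzerodivisor modulo the annihilator of `u`, so the dimension drops by at least one.
    refine le_trans ?_ (ringKrullDim_succ_le_of_surjective (Ideal.Quotient.factor hle)
      (Ideal.Quotient.factor_surjective hle) (r := Ideal.Quotient.mk _ x) ?_ ?_)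
    · push_cast
      gcongr
      exact ih hd hw'
    · rw [mem_nonZeroDivisors_iff_right]
      intro r hr
      obtain ⟨r, rfl⟩ := Ideal.Quotient.mk_surjective r
      rw [← map_mul, Ideal.Quotient.eq_zero_iff_mem, htors] at hr
      rw [Ideal.Quotient.eq_zero_iff_mem, htors]
      exact hxr.right_eq_zero_of_smul (by simpa [mul_smul, smul_comm x r] using hr)
    · rw [Ideal.Quotient.factor_mk, Ideal.Quotient.eq_zero_iff_mem]
      exact hx0

end LocalAlgebra

/-! ### Weakly regular sequences and short exact sequences. -/

section ExactSequence

open RingTheory.Sequence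
open scoped Pointwise

/-- An extension of modules on which a sequence is weakly regular has the same property. -/
theorem isWeaklyRegular_of_exact {R : Type*} [CommRing R] (rs : List R) :
    ∀ {M₁ M₂ M₃ : Type*} [AddCommGroup M₁] [AddCommGroup M₂] [AddCommGroup M₃]
      [Module R M₁] [Module R M₂] [Module R M₃] {f : M₁ →ₗ[R] M₂} {g : M₂ →ₗ[R] M₃},
      Function.Injective f → Function.Exact f g → Function.Surjective g →
      IsWeaklyRegular M₁ rs → IsWeaklyRegular M₃ rs → IsWeaklyRegular M₂ rs := by
  induction rs with
  | nil => exact fun _ _ _ _ _ => .nil _ _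
  | cons r rs ih =>
    intro M₁ M₂ M₃ _ _ _ _ _ _ f g hf hfg hg h₁ h₃
    rw [isWeaklyRegular_cons_iff] at h₁ h₃ ⊢
    refine ⟨?_, ih (f := QuotSMulTop.map r f) (g := QuotSMulTop.map r g) ?_
      (QuotSMulTop.map_exact r hfg hg) (QuotSMulTop.map_surjective r hg) h₁.2 h₃.2⟩
    · refine isSMulRegular_iff_right_eq_zero_of_smul.2 fun m hm => ?_
      have h0 : g m = 0 := h₃.1.right_eq_zero_of_smul (by rw [← map_smul, hm, map_zero])
      obtain ⟨n, rfl⟩ := (hfg m).1 h0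
      rw [← map_smul] at hm
      rw [h₁.1.right_eq_zero_of_smul (hf (hm.trans (map_zero f).symm)), map_zero]
    -- Regularity of `r` on `M₃` is what keeps `M₁/rM₁ → M₂/rM₂` injective.
    · rw [← LinearMap.ker_eq_bot, LinearMap.ker_eq_bot']
      intro n hn
      obtain ⟨n, rfl⟩ := Submodule.Quotient.mk_surjective _ n
      rw [QuotSMulTop.map_apply_mk, Submodule.Quotient.mk_eq_zero,
        Submodule.mem_smul_pointwise_iff_exists] at hn
      obtain ⟨m, -, hm⟩ := hn
      have h0 : g m = 0 := h₃.1.right_eq_zero_of_smul (by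
        rw [← map_smul, hm, hfg.apply_apply_eq_zero])
      obtain ⟨t, rfl⟩ := (hfg m).1 h0
      rw [← map_smul] at hm
      rw [← hf hm]
      exact (Submodule.Quotient.mk_eq_zero _).2 (Submodule.smul_mem_pointwise_smul _ _ _ trivial)

/-- Weak regularity on `R ⧸ I` follows from that on `R ⧸ (I : f)` and `R ⧸ (I + (f))`. -/
theorem isWeaklyRegular_quotient_of_colon {R : Type*} [CommRing R] {I J L : Ideal R} {f : R}
    (hJ : ∀ g, g ∈ J ↔ f * g ∈ I) (hL : L = I ⊔ Ideal.span {f}) {rs : List R}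
    (h₁ : IsWeaklyRegular (R ⧸ J) rs) (h₂ : IsWeaklyRegular (R ⧸ L) rs) :
    IsWeaklyRegular (R ⧸ I) rs := by
  have hIL : I ≤ L := hL ▸ le_sup_left
  have hJI : J ≤ Submodule.comap (LinearMap.mulLeft R f) I := fun g hg => (hJ g).1 hg
  -- The sequence is `0 → R/J → R/I → R/L → 0`, whose first map is multiplication by `f`.
  refine isWeaklyRegular_of_exact rs (f := Submodule.mapQ J I (LinearMap.mulLeft R f) hJI)
    (g := Submodule.factor hIL) ?_ ?_ (Submodule.factor_surjective hIL) h₁ h₂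
  · rw [← LinearMap.ker_eq_bot, LinearMap.ker_eq_bot']
    intro n hn
    obtain ⟨n, rfl⟩ := Submodule.Quotient.mk_surjective _ n
    change (Submodule.Quotient.mk (f * n) : R ⧸ I) = 0 at hn
    rw [Submodule.Quotient.mk_eq_zero] at hn
    exact (Submodule.Quotient.mk_eq_zero _).2 ((hJ n).2 hn)
  · intro n
    obtain ⟨n, rfl⟩ := Submodule.Quotient.mk_surjective _ n
    change (Submodule.Quotient.mk n : R ⧸ L) = 0 ↔
      ∃ y, Submodule.mapQ J I (LinearMap.mulLeft R f) hJI y = Submodule.Quotient.mk n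
    rw [Submodule.Quotient.mk_eq_zero, hL, Submodule.mem_sup]
    constructor
    · rintro ⟨a, ha, b, hb, rfl⟩
      obtain ⟨c, rfl⟩ := Ideal.mem_span_singleton'.1 hb
      refine ⟨Submodule.Quotient.mk c, ?_⟩
      rw [Submodule.mapQ_apply, Submodule.Quotient.eq]
      simpa [mul_comm] using ha
    · rintro ⟨c, hc⟩
      obtain ⟨c, rfl⟩ := Submodule.Quotient.mk_surjective _ c
      rw [Submodule.mapQ_apply, Submodule.Quotient.eq] at hc
      exact ⟨n - f * c, by simpa using I.neg_mem hc, f * c,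
        Ideal.mul_mem_right _ _ (Ideal.mem_span_singleton_self f), by ring⟩

theorem isWeaklyRegular_quotient_cons {R : Type*} [CommRing R] {I L : Ideal R} {f : R}
    (hL : L = I ⊔ Ideal.span {f}) (hf : ∀ g, f * g ∈ I → g ∈ I) {rs : List R}
    (h : IsWeaklyRegular (R ⧸ L) rs) : IsWeaklyRegular (R ⧸ I) (f :: rs) := by
  rw [isWeaklyRegular_cons_iff]
  refine ⟨(isSMulRegular_quotient_iff_mem_of_smul_mem _ _).2 hf, ?_⟩
  have e : QuotSMulTop f (R ⧸ I) ≃ₗ[R] R ⧸ L :=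
    Submodule.quotEquivOfEq _ _ (by
      rw [Submodule.map_pointwise_smul, Submodule.map_top, Submodule.range_mkQ]) ≪≫ₗ
    Submodule.quotientQuotientEquivQuotientSup I (f • ⊤ : Submodule R R) ≪≫ₗ
    Submodule.quotEquivOfEq _ _ (by
      rw [hL, ← Submodule.ideal_span_singleton_smul, smul_eq_mul, Ideal.mul_top])
  exact (e.isWeaklyRegular_congr rs).2 h

end ExactSequence

/-! ### Stanley–Reisner ideals and restriction to faces. -/

namespace SComplex

variable {V : Type*} {K : Type*} [Field K]

section Monomials

/-- The exponent of the squarefree monomial of a finite set. -/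
noncomputable def sqfreeExp (F : Finset V) : V →₀ ℕ := ∑ v ∈ F, Finsupp.single v 1

theorem sqfreeExp_apply [DecidableEq V] (F : Finset V) (v : V) :
    sqfreeExp F v = if v ∈ F then 1 else 0 := by
  simp [sqfreeExp, Finsupp.finsetSum_apply, Finsupp.single_apply]

theorem sqfreeExp_le_iff {F : Finset V} {m : V →₀ ℕ} : sqfreeExp F ≤ m ↔ F ⊆ m.support := by
  classical
  simp only [Finsupp.le_def, sqfreeExp_apply, Finset.subset_iff, Finsupp.mem_support_iff]
  refine forall_congr' fun v => ?_
  split_ifs with h <;> simp [h, Nat.one_le_iff_ne_zero]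

theorem support_sqfreeExp_add [DecidableEq V] (F : Finset V) (m : V →₀ ℕ) :
    (sqfreeExp F + m).support = F ∪ m.support := by
  ext v
  simp only [Finsupp.mem_support_iff, Finsupp.add_apply, sqfreeExp_apply, Finset.mem_union]
  split_ifs with h <;> simp [h]

theorem prod_X_eq_monomial (F : Finset V) :
    ∏ v ∈ F, (MvPolynomial.X v : MvPolynomial V K) = MvPolynomial.monomial (sqfreeExp F) 1 := by
  rw [sqfreeExp, MvPolynomial.monomial_sum_one]
  rfl

/-- The ideal is monomial, and a monomial is divisible by that of a non-face exactly when its own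
support is a non-face. -/
theorem mem_stanleyReisnerIdeal {Δ : SComplex V} {f : MvPolynomial V K} :
    f ∈ Δ.stanleyReisnerIdeal K ↔ ∀ m ∈ f.support, m.support ∉ Δ.faces := by
  have h : {f : MvPolynomial V K | ∃ F : Finset V, F ∉ Δ.faces ∧ f = ∏ v ∈ F, MvPolynomial.X v} =
      (fun s => MvPolynomial.monomial s (1 : K)) '' (sqfreeExp '' {F | F ∉ Δ.faces}) := by
    ext f
    simp only [Set.mem_ofPred_eq, Set.mem_image, exists_exists_and_eq_and, prod_X_eq_monomial]
    exact exists_congr fun F => and_congr_right fun _ => eq_comm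
  rw [stanleyReisnerIdeal, h, MvPolynomial.mem_ideal_span_monomial_image]
  refine forall₂_congr fun m _ => ?_
  simp only [Set.mem_image, Set.mem_ofPred_eq, exists_exists_and_eq_and, sqfreeExp_le_iff]
  exact ⟨fun ⟨F, hF, hm⟩ h => hF (Δ.down_closed h hm), fun h => ⟨_, h, subset_rfl⟩⟩

theorem prod_X_mem_stanleyReisnerIdeal {Δ : SComplex V} {F : Finset V} (h : F ∉ Δ.faces) :
    ∏ v ∈ F, (MvPolynomial.X v : MvPolynomial V K) ∈ Δ.stanleyReisnerIdeal K :=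
  Ideal.subset_span ⟨F, h, rfl⟩

/-- Setting the variables outside of `F` to zero. -/
noncomputable def restrictVars [DecidableEq V] (F : Finset V) :
    MvPolynomial V K →ₐ[K] MvPolynomial V K :=
  MvPolynomial.aeval fun v => if v ∈ F then MvPolynomial.X v else 0

theorem restrictVars_prod_X [DecidableEq V] (F A : Finset V) :
    restrictVars F (∏ v ∈ A, (MvPolynomial.X v : MvPolynomial V K)) =
      if A ⊆ F then ∏ v ∈ A, MvPolynomial.X v else 0 := by
  simp only [restrictVars, map_prod, MvPolynomial.aeval_X]
  split_ifs with h
  · exact Finset.prod_congr rfl fun v hv => if_pos (h hv)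
  · obtain ⟨v, hv, hvF⟩ := Finset.not_subset.1 h
    exact Finset.prod_eq_zero hv (if_neg hvF)

theorem coeff_restrictVars [DecidableEq V] (F : Finset V) (m : V →₀ ℕ) (f : MvPolynomial V K) :
    (restrictVars F f).coeff m = if m.support ⊆ F then f.coeff m else 0 := by
  induction f using MvPolynomial.induction_on' with
  | monomial u a =>
    have h : restrictVars F (MvPolynomial.monomial u a) =
        if u.support ⊆ F then MvPolynomial.monomial u a else 0 := by
      rw [restrictVars, MvPolynomial.aeval_monomial]
      split_ifs with h
      · rw [MvPolynomial.monomial_eq, MvPolynomial.algebraMap_eq]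
        congr 1
        exact Finset.prod_congr rfl fun v hv => by simp only [if_pos (h hv)]
      · obtain ⟨v, hv, hvF⟩ := Finset.not_subset.1 h
        rw [Finsupp.prod, Finset.prod_eq_zero hv, mul_zero]
        rw [if_neg hvF, zero_pow (Finsupp.mem_support_iff.1 hv)]
    rw [h]
    by_cases hum : u = m
    · subst hum
      split_ifs <;> simp
    · split_ifs <;> simp [MvPolynomial.coeff_monomial, hum]
  | add p q hp hq =>
    rw [map_add, MvPolynomial.coeff_add, hp, hq, MvPolynomial.coeff_add]
    split_ifs <;> simp

/-- Identities in `K[Δ]` can thus be checked face by face inside the polynomial ring, which is a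
domain. -/
theorem mem_stanleyReisnerIdeal_iff_restrictVars [DecidableEq V] {Δ : SComplex V}
    {f : MvPolynomial V K} :
    f ∈ Δ.stanleyReisnerIdeal K ↔ ∀ F ∈ Δ.faces, restrictVars F f = 0 := by
  rw [mem_stanleyReisnerIdeal]
  constructor
  · intro h F hF
    ext m
    rw [coeff_restrictVars, MvPolynomial.coeff_zero]
    split_ifs with hm
    · by_contra hc
      exact h m (MvPolynomial.mem_support_iff.2 hc) (Δ.down_closed hF hm)
    · rfl
  · intro h m hm hF
    have := congrArg (MvPolynomial.coeff m) (h _ hF)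
    rw [coeff_restrictVars, if_pos subset_rfl, MvPolynomial.coeff_zero] at this
    exact MvPolynomial.mem_support_iff.1 hm this

/-- It suffices to test the faces in a generating set. -/
theorem mem_stanleyReisnerIdeal_of_generatedBy [DecidableEq V] {S : Set (Finset V)}
    {f : MvPolynomial V K} :
    f ∈ (generatedBy S).stanleyReisnerIdeal K ↔ ∀ F ∈ S, restrictVars F f = 0 := by
  rw [mem_stanleyReisnerIdeal_iff_restrictVars]
  refine ⟨fun h F hF => h F ⟨F, hF, subset_rfl⟩, fun h F ⟨G, hG, hFG⟩ => ?_⟩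
  ext m
  rw [coeff_restrictVars, MvPolynomial.coeff_zero]
  split_ifs with hm
  · have := congrArg (MvPolynomial.coeff m) (h _ hG)
    rwa [coeff_restrictVars, if_pos (hm.trans hFG), MvPolynomial.coeff_zero] at this
  · rfl

/-- Killing the monomial of `R` removes exactly the faces containing `R`. This is the right-hand
term of the exact sequence of a shelling step. -/
theorem stanleyReisnerIdeal_sup_span {Γ Γ' : SComplex V} {R : Finset V}
    (h : ∀ A, A ∈ Γ'.faces ↔ A ∈ Γ.faces ∧ ¬R ⊆ A) :
    Γ'.stanleyReisnerIdeal K =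
      Γ.stanleyReisnerIdeal K ⊔ Ideal.span {∏ v ∈ R, MvPolynomial.X v} := by
  apply le_antisymm
  · refine Ideal.span_le.2 ?_
    rintro _ ⟨A, hA, rfl⟩
    rw [h, not_and_not_right] at hA
    by_cases hAΓ : A ∈ Γ.faces
    · exact Ideal.mem_sup_right (Ideal.mem_span_singleton.2
        (Finset.prod_dvd_prod_of_subset _ _ _ (hA hAΓ)))
    · exact Ideal.mem_sup_left (prod_X_mem_stanleyReisnerIdeal hAΓ)
  · refine sup_le (Ideal.span_le.2 ?_) ?_
    · rintro _ ⟨A, hA, rfl⟩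
      exact prod_X_mem_stanleyReisnerIdeal fun hc => hA ((h A).1 hc).1
    · rw [Ideal.span_singleton_le_iff_mem]
      exact prod_X_mem_stanleyReisnerIdeal fun hc => ((h R).1 hc).2 subset_rfl

theorem mem_simplex_faces {F A : Finset V} : A ∈ (simplex F).faces ↔ A ⊆ F := by
  simp [simplex, generatedBy]

/-- The colon ideal by the monomial of `R` is the ideal of the attached simplex, because multiplying
a monomial by it adds `R` to the support. This is the left-hand term of the exact sequence of a
shelling step. -/
theorem prod_X_mul_mem_stanleyReisnerIdeal {Γ : SComplex V} {R F : Finset V} (hRF : R ⊆ F)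
    (h : ∀ A, R ⊆ A → (A ∈ Γ.faces ↔ A ⊆ F)) (g : MvPolynomial V K) :
    g ∈ (simplex F).stanleyReisnerIdeal K ↔
      (∏ v ∈ R, MvPolynomial.X v) * g ∈ Γ.stanleyReisnerIdeal K := by
  classical
  rw [mem_stanleyReisnerIdeal, mem_stanleyReisnerIdeal, prod_X_eq_monomial]
  simp only [mem_simplex_faces]
  constructor
  · intro hg m hm
    rw [MvPolynomial.mem_support_iff, MvPolynomial.coeff_monomial_mul'] at hm
    split_ifs at hm with hle
    · obtain ⟨u, rfl⟩ := exists_add_of_le hle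
      rw [add_tsub_cancel_left, one_mul] at hm
      have := hg u (MvPolynomial.mem_support_iff.2 hm)
      rw [support_sqfreeExp_add, h _ Finset.subset_union_left]
      exact fun hc => this (Finset.subset_union_right.trans hc)
    · exact absurd rfl hm
  · intro hg m hm hmF
    refine hg (sqfreeExp R + m) ?_ ?_
    · rw [MvPolynomial.mem_support_iff, MvPolynomial.coeff_monomial_mul, one_mul]
      exact MvPolynomial.mem_support_iff.1 hm
    · rw [support_sqfreeExp_add, h _ Finset.subset_union_left]
      exact Finset.union_subset hRF hmF

end Monomials

end SComplex

/-! ### Pure shellings. -/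

namespace SComplex

variable {V : Type*}

/-- The complexes obtained from a simplex on `k` vertices by successively attaching simplices
on `k` vertices, each along a union of some of its facets: those opposite to the vertices in
`R`, so that the new faces form the interval between `R` and `F`. -/
inductive PureShellable (k : ℕ) : SComplex V → Prop
  | of_simplex (F : Finset V) (hF : F.card = k) : PureShellable k (simplex F)
  | attach (Γ Γ' : SComplex V) (R F : Finset V) (hF : F.card = k) (hRF : R ⊆ F)
      (hold : ∀ A, A ∈ Γ'.faces ↔ A ∈ Γ.faces ∧ ¬R ⊆ A)
      (hnew : ∀ A, R ⊆ A → (A ∈ Γ.faces ↔ A ⊆ F)) (h : PureShellable k Γ') :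
      PureShellable k Γ

/-- The join of the simplex on `S` with a skeleton of the simplex on `N` may be attached along
the join of the boundary of the former with the latter. -/
theorem PureShellable.attach_skeleton [DecidableEq V] {k : ℕ} (N : Finset V) :
    ∀ (S : Finset V) (m : ℕ) (Γ' Γ : SComplex V), Disjoint N S → m ≤ N.card → S.card + m = k →
      (∀ A ⊆ N ∪ S, (A ∩ N).card ≤ m → (A ∈ Γ'.faces ↔ ¬S ⊆ A)) →
      (∀ A, A ∈ Γ.faces ↔ A ∈ Γ'.faces ∨ (S ⊆ A ∧ A ⊆ N ∪ S ∧ (A ∩ N).card ≤ m)) →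
      PureShellable k Γ' → PureShellable k Γ := by
  -- For `m = |N|` the skeleton is the full simplex on `N`, and a single simplex is attached. The
  -- case `m = 0` reduces to this with `N` replaced by `∅`.
  have hbase : ∀ (N S : Finset V) (m : ℕ) (Γ' Γ : SComplex V), Disjoint N S → m = N.card →
      S.card + m = k →
      (∀ A ⊆ N ∪ S, (A ∩ N).card ≤ m → (A ∈ Γ'.faces ↔ ¬S ⊆ A)) →
      (∀ A, A ∈ Γ.faces ↔ A ∈ Γ'.faces ∨ (S ⊆ A ∧ A ⊆ N ∪ S ∧ (A ∩ N).card ≤ m)) →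
      PureShellable k Γ' → PureShellable k Γ := by
    intro N S m Γ' Γ hNS hm hk hΓ' hΓ h
    have hS : ∀ A ∈ Γ'.faces, ¬S ⊆ A := fun A hA hSA =>
      (hΓ' S Finset.subset_union_right (by
        rw [Finset.inter_comm, Finset.disjoint_iff_inter_eq_empty.1 hNS]; simp)).1
        (Γ'.down_closed hA hSA) subset_rfl
    refine .attach Γ Γ' S (N ∪ S) ?_ Finset.subset_union_right ?_ ?_ h
    · rw [Finset.card_union_of_disjoint hNS]; lia
    · intro A
      rw [hΓ]
      exact ⟨fun hA => ⟨.inl hA, hS A hA⟩, fun ⟨hA, hSA⟩ => hA.resolve_right fun hc => hSA hc.1⟩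
    · intro A hSA
      rw [hΓ]
      refine ⟨fun hA => (hA.resolve_left fun hc => hS A hc hSA).2.1, fun hA => .inr ⟨hSA, hA, ?_⟩⟩
      exact hm ▸ Finset.card_le_card Finset.inter_subset_right
  induction N using Finset.induction with
  | empty => exact fun S m Γ' Γ hd hm => hbase ∅ S m Γ' Γ hd (by simpa using hm)
  | insert a N ha ih =>
    intro S m Γ' Γ hd hm hk hΓ' hΓ h
    have hcard : (insert a N).card = N.card + 1 := Finset.card_insert_of_notMem ha
    obtain ⟨haS, hNS⟩ := Finset.disjoint_insert_left.1 hd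
    by_cases hm1 : m = N.card + 1
    · exact hbase _ S m Γ' Γ hd (by lia) hk hΓ' hΓ h
    rcases Nat.eq_zero_or_pos m with rfl | hm0
    · refine hbase ∅ S 0 Γ' Γ (by simp) rfl hk ?_ ?_ h
      · intro A hA _
        refine hΓ' A (hA.trans (Finset.union_subset_union (by simp) subset_rfl)) ?_
        rw [Finset.empty_union] at hA
        rw [Nat.le_zero, Finset.card_eq_zero, ← Finset.disjoint_iff_inter_eq_empty]
        exact (hd.mono_right hA).symm
      · intro A
        rw [hΓ]
        refine or_congr_right (and_congr_right fun _ => ?_)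
        rw [Nat.le_zero, Finset.card_eq_zero, ← Finset.disjoint_iff_inter_eq_empty,
          Finset.empty_union]
        constructor
        · exact fun ⟨h1, h2⟩ => ⟨fun x hx => (Finset.mem_union.1 (h1 hx)).resolve_left
            (Finset.disjoint_left.1 h2 hx), by simp⟩
        · exact fun ⟨h1, _⟩ => ⟨h1.trans Finset.subset_union_right, (hd.mono_right h1).symm⟩
    · have hinter : ∀ A : Finset V, a ∉ A → A ∩ insert a N = A ∩ N := fun A hA =>
        Finset.inter_insert_of_notMem hA
      have hinter' : ∀ A : Finset V, a ∈ A → (A ∩ insert a N).card = (A ∩ N).card + 1 := by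
        intro A hA
        rw [Finset.inter_insert_of_mem hA, Finset.card_insert_of_notMem (by simp [ha])]
      -- The new faces are split by whether they contain `a`. Those avoiding `a` pose the same
      -- problem for `N`, `S`, `m` and produce `Γ₁`; the others pose it for `N`, `insert a S`, `m -
      -- 1`.
      let Γ₁ : SComplex V :=
        { faces := {A | A ∈ Γ'.faces ∨ (S ⊆ A ∧ A ⊆ N ∪ S ∧ (A ∩ N).card ≤ m)}
          down_closed := by
            rintro A B (hA | ⟨h1, h2, h3⟩) hBA
            · exact .inl (Γ'.down_closed hA hBA)
            · have h4 : (B ∩ N).card ≤ m :=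
                (Finset.card_le_card (Finset.inter_subset_inter_right hBA)).trans h3
              by_cases hSB : S ⊆ B
              · exact .inr ⟨hSB, hBA.trans h2, h4⟩
              · have haB : a ∉ B := fun hc => by
                  have := h2 (hBA hc)
                  simp [ha, haS] at this
                exact .inl ((hΓ' B ((hBA.trans h2).trans (Finset.union_subset_union
                  (Finset.subset_insert _ _) subset_rfl)) (by rwa [hinter B haB])).2 hSB) }
      have hsub : N ∪ S ⊆ insert a N ∪ S :=
        Finset.union_subset_union (Finset.subset_insert _ _) subset_rfl
      have h₁ : PureShellable k Γ₁ := by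
        refine ih S m Γ' Γ₁ hNS (by lia) hk ?_ (fun A => Iff.rfl) h
        intro A hA hAN
        have haA : a ∉ A := fun hc => by
          have := hA hc
          simp [ha, haS] at this
        exact hΓ' A (hA.trans hsub) (by rwa [hinter A haA])
      have hins : N ∪ insert a S = insert a N ∪ S := by
        rw [Finset.union_insert, Finset.insert_union]
      refine ih (insert a S) (m - 1) Γ₁ Γ (Finset.disjoint_insert_right.2 ⟨ha, hNS⟩) (by lia)
        (by rw [Finset.card_insert_of_notMem haS]; lia) ?_ ?_ h₁
      · intro A hA hAN
        rw [hins] at hA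
        have hAm : (A ∩ insert a N).card ≤ m := by
          by_cases haA : a ∈ A
          · rw [hinter' A haA]; lia
          · rw [hinter A haA]; lia
        change (A ∈ Γ'.faces ∨ _) ↔ _
        rw [hΓ' A hA hAm, Finset.insert_subset_iff]
        constructor
        · rintro (h1 | ⟨-, h2, -⟩) ⟨h3, h4⟩
          · exact h1 h4
          · have := h2 h3
            simp [ha, haS] at this
        · intro hc
          by_cases hSA : S ⊆ A
          · refine .inr ⟨hSA, fun x hx => ?_, by lia⟩
            have hxa : x ≠ a := by rintro rfl; exact hc ⟨hx, hSA⟩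
            have := hA hx
            simp only [Finset.mem_union, Finset.mem_insert, hxa, false_or] at this ⊢
            exact this
          · exact .inl hSA
      · intro A
        rw [hΓ, hins]
        change _ ↔ (A ∈ Γ'.faces ∨ _) ∨ _
        rw [or_assoc]
        refine or_congr_right ?_
        rw [Finset.insert_subset_iff]
        constructor
        · rintro ⟨h1, h2, h3⟩
          by_cases haA : a ∈ A
          · rw [hinter' A haA] at h3
            exact .inr ⟨⟨haA, h1⟩, h2, by lia⟩
          · rw [hinter A haA] at h3
            refine .inl ⟨h1, fun x hx => ?_, h3⟩
            have hxa : x ≠ a := by rintro rfl; exact haA hx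
            have := h2 hx
            simp only [Finset.mem_union, Finset.mem_insert, hxa, false_or] at this ⊢
            exact this
        · rintro (⟨h1, h2, h3⟩ | ⟨⟨h0, h1⟩, h2, h3⟩)
          · have haA : a ∉ A := fun hc => by
              have := h2 hc
              simp [ha, haS] at this
            exact ⟨h1, h2.trans hsub, by rwa [hinter A haA]⟩
          · exact ⟨h1, h2, by rw [hinter' A h0]; lia⟩

/-- The boundary of the simplex on `F`. -/
def boundary (F : Finset V) : SComplex V where
  faces := {A | A ∈ (simplex F).faces ∧ ¬F ⊆ A}
  down_closed := fun _ _ hA hBA =>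
    ⟨(simplex F).down_closed hA.1 hBA, fun h => hA.2 (h.trans hBA)⟩

/-- The boundary of the simplex on `insert v N` is the simplex on `N` together with the cone from
`v` over the proper subsets of `N`, that is, over a skeleton. -/
theorem pureShellable_boundary [DecidableEq V] {k : ℕ} {F : Finset V} (hF : F.card = k + 1) :
    PureShellable k (boundary F) := by
  obtain ⟨v, N, hv, rfl, hN⟩ := Finset.card_eq_succ.1 hF
  have hmem : ∀ A, A ∈ (boundary (insert v N)).faces ↔ A ⊆ insert v N ∧ ¬insert v N ⊆ A :=
    fun A => and_congr_left fun _ => mem_simplex_faces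
  have hvA : ∀ A ⊆ N, v ∉ A := fun A hA h => hv (hA h)
  have hvN : ∀ A : Finset V, v ∉ A → A ⊆ insert v N → A ⊆ N := fun A h hA =>
    (Finset.subset_insert_iff_of_notMem h).1 hA
  rcases Nat.eq_zero_or_pos k with rfl | hk
  -- Here the skeleton size `k - 1` would be truncated; the boundary of a point is `{∅}`.
  · have : boundary (insert v N) = simplex N := by
      ext A
      rw [hmem, mem_simplex_faces]
      obtain rfl := Finset.card_eq_zero.1 hN
      constructor
      · rintro ⟨h1, h2⟩
        refine hvN A (fun h => h2 (by simpa using h)) h1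
      · intro h
        exact ⟨h.trans (Finset.subset_insert _ _), fun hc => hvA A h (hc (by simp))⟩
    rw [this]
    exact .of_simplex N hN
  · refine .attach_skeleton N {v} (k - 1) (simplex N) _ (by simpa using hv) (by lia)
      (by rw [Finset.card_singleton]; lia) ?_ ?_ (.of_simplex N hN)
    · intro A hA _
      rw [mem_simplex_faces, Finset.singleton_subset_iff]
      exact ⟨hvA A, fun h => hvN A h (hA.trans (by rw [Finset.union_comm, Finset.insert_eq]))⟩
    · intro A
      rw [hmem, mem_simplex_faces, Finset.singleton_subset_iff, Finset.union_comm,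
        ← Finset.insert_eq]
      constructor
      · rintro ⟨h1, h2⟩
        by_cases hvA' : v ∈ A
        · refine .inr ⟨hvA', h1, ?_⟩
          have : (A ∩ N).card < N.card := Finset.card_lt_card <|
            Finset.ssubset_iff_subset_ne.2 ⟨Finset.inter_subset_right, fun he => h2 ?_⟩
          · lia
          · exact Finset.insert_subset hvA' (Finset.inter_eq_right.1 he)
        · exact .inl (hvN A hvA' h1)
      · rintro (h | ⟨h1, h2, h3⟩)
        · exact ⟨h.trans (Finset.subset_insert _ _),
            fun hc => hvA A h (hc (Finset.mem_insert_self _ _))⟩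
        · refine ⟨h2, fun hc => ?_⟩
          have : A ∩ N = N := Finset.inter_eq_right.2 ((Finset.subset_insert _ _).trans hc)
          rw [this] at h3
          lia

theorem mem_stanleyReisnerIdeal_simplex [DecidableEq V] {K : Type*} [Field K] {F : Finset V}
    {f : MvPolynomial V K} :
    f ∈ (simplex F).stanleyReisnerIdeal K ↔ restrictVars F f = 0 := by
  rw [simplex, mem_stanleyReisnerIdeal_of_generatedBy]
  simp

theorem prod_X_ne_zero {K : Type*} [Field K] (F : Finset V) :
    ∏ v ∈ F, (MvPolynomial.X v : MvPolynomial V K) ≠ 0 :=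
  Finset.prod_ne_zero_iff.2 fun v _ => MvPolynomial.X_ne_zero v

/-! ### Elementary symmetric polynomials as a regular sequence. -/

section Regular

open RingTheory.Sequence

variable (V) [Fintype V] (K : Type*) [Field K]

/-- The elementary symmetric polynomials in all variables, of degrees `k, k - 1, …, 1`. -/
noncomputable def esymmList : ℕ → List (MvPolynomial V K)
  | 0 => []
  | k + 1 => MvPolynomial.esymm V K (k + 1) :: esymmList k

theorem length_esymmList (k : ℕ) : (esymmList V K k).length = k := by
  induction k with
  | zero => rfl
  | succ k ih => rw [esymmList, List.length_cons, ih]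

theorem exists_eq_esymm_of_mem_esymmList (k : ℕ) :
    ∀ f ∈ esymmList V K k, ∃ i, f = MvPolynomial.esymm V K (i + 1) := by
  induction k with
  | zero => simp [esymmList]
  | succ k ih =>
    intro f hf
    rw [esymmList, List.mem_cons] at hf
    exact hf.elim (fun h => ⟨k, h⟩) (ih f)

variable {V K}

theorem restrictVars_esymm [DecidableEq V] (F : Finset V) :
    restrictVars F (MvPolynomial.esymm V K F.card) = ∏ v ∈ F, MvPolynomial.X v := by
  rw [MvPolynomial.esymm, map_sum]
  simp only [restrictVars_prod_X]
  rw [Finset.sum_eq_single F]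
  · rw [if_pos subset_rfl]
  · intro A hA hne
    refine if_neg fun h => hne ?_
    exact Finset.eq_of_subset_of_card_le h (Finset.mem_powersetCard.1 hA).2.ge
  · intro h
    exact absurd (Finset.mem_powersetCard.2 ⟨Finset.subset_univ _, rfl⟩) h

/-- On a simplex with `k + 1` vertices the top polynomial acts as the product of its variables. That
product is regular and its quotient belongs to the boundary, a shellable complex with `k`-element
facets, so the descending order of degrees suits the induction. Attached simplices are absorbed by
the exact sequence of the colon ideal. -/
theorem isWeaklyRegular_esymmList [DecidableEq V] (k : ℕ) : ∀ {Γ : SComplex V},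
    PureShellable k Γ →
      IsWeaklyRegular (MvPolynomial V K ⧸ Γ.stanleyReisnerIdeal K) (esymmList V K k) := by
  induction k with
  | zero => exact fun _ => .nil _ _
  | succ k ih =>
    intro Γ h
    have hsimplex : ∀ F : Finset V, F.card = k + 1 →
        IsWeaklyRegular (MvPolynomial V K ⧸ (simplex F).stanleyReisnerIdeal K)
          (esymmList V K (k + 1)) := by
      intro F hF
      have hres : restrictVars F (MvPolynomial.esymm V K (k + 1)) = ∏ v ∈ F, MvPolynomial.X v :=
        hF ▸ restrictVars_esymm F
      refine isWeaklyRegular_quotient_cons ?_ ?_ (ih (pureShellable_boundary hF))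
      · rw [stanleyReisnerIdeal_sup_span (Γ := simplex F) (R := F) fun A => Iff.rfl]
        have hd : ∏ v ∈ F, MvPolynomial.X v - MvPolynomial.esymm V K (k + 1) ∈
            (simplex F).stanleyReisnerIdeal K := by
          rw [mem_stanleyReisnerIdeal_simplex, map_sub, hres, restrictVars_prod_X,
            if_pos subset_rfl, sub_self]
        apply le_antisymm <;> refine sup_le le_sup_left ?_ <;>
          rw [Ideal.span_singleton_le_iff_mem]
        · have := Ideal.add_mem _ (Ideal.mem_sup_left (T := Ideal.span
            {MvPolynomial.esymm V K (k + 1)}) hd)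
            (Ideal.mem_sup_right (Ideal.mem_span_singleton_self _))
          rwa [sub_add_cancel] at this
        · have := Ideal.sub_mem _ (Ideal.mem_sup_right (S := (simplex F).stanleyReisnerIdeal K)
            (Ideal.mem_span_singleton_self (∏ v ∈ F, MvPolynomial.X v))) (Ideal.mem_sup_left hd)
          rwa [sub_sub_cancel] at this
      · intro g hg
        rw [mem_stanleyReisnerIdeal_simplex, map_mul, hres] at hg
        rw [mem_stanleyReisnerIdeal_simplex]
        exact (mul_eq_zero.1 hg).resolve_left (prod_X_ne_zero F)
    induction h with
    | of_simplex F hF => exact hsimplex F hF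
    | attach Γ Γ' R F hF hRF hold hnew _ ih' =>
      exact isWeaklyRegular_quotient_of_colon (prod_X_mul_mem_stanleyReisnerIdeal hRF hnew)
        (stanleyReisnerIdeal_sup_span hold) (hsimplex F hF) ih'

end Regular

end SComplex

/-! ### Krull dimension of localizations and of Stanley–Reisner rings. -/

section KrullDimension

theorem ringKrullDim_quotient_le_comap {R A : Type*} [CommRing R] [CommRing A] [Algebra R A]
    (M : Submonoid R) [IsLocalization M A] (T : Ideal A) :
    ringKrullDim (A ⧸ T) ≤ ringKrullDim (R ⧸ T.comap (algebraMap R A)) := by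
  rw [ringKrullDim_quotient, ringKrullDim_quotient]
  refine Order.krullDim_le_of_strictMono
    (fun p => ⟨PrimeSpectrum.comap (algebraMap R A) p.1, fun _ hx => p.2 hx⟩) fun p q hpq => ?_
  refine lt_of_le_of_ne (fun x hx => (show p.1.asIdeal ≤ q.1.asIdeal from hpq.le) hx) fun he => ?_
  exact hpq.ne (Subtype.ext (PrimeSpectrum.localization_comap_injective A M
    (Subtype.ext_iff.1 he)))

theorem ringKrullDim_le_of_isLocalization {R : Type*} (A : Type*) [CommRing R] [CommRing A]
    [Algebra R A] (M : Submonoid R) [IsLocalization M A] : ringKrullDim A ≤ ringKrullDim R :=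
  Order.krullDim_le_of_strictMono (PrimeSpectrum.comap (algebraMap R A)) fun p q hpq =>
    lt_of_le_of_ne (fun _ hx => (show p.asIdeal ≤ q.asIdeal from hpq.le) hx) fun he =>
      hpq.ne (PrimeSpectrum.localization_comap_injective A M he)

/-- A weakly regular sequence in a prime ideal is at most as long as the dimension. -/
theorem RingTheory.Sequence.IsWeaklyRegular.length_le_ringKrullDim_of_isPrime {R : Type*}
    [CommRing R] [IsNoetherianRing R] {rs : List R} (hreg : IsWeaklyRegular R rs)
    (p : Ideal R) [p.IsPrime] (hrs : ∀ r ∈ rs, r ∈ p) :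
    (rs.length : WithBot ℕ∞) ≤ ringKrullDim R := by
  have hA := hreg.isRegular_of_isLocalization_of_mem (Localization.AtPrime p) p hrs
  have h1 := ringKrullDim_add_length_eq_ringKrullDim_of_isRegular _ hA
  have h2 : Nontrivial (Localization.AtPrime p ⧸
      Ideal.ofList (rs.map (algebraMap R (Localization.AtPrime p)))) := by
    rw [Ideal.Quotient.nontrivial_iff]
    intro hc
    apply hA.2
    rw [hc]
    simp
  rw [List.length_map] at h1
  have h3 : (rs.length : WithBot ℕ∞) ≤ ringKrullDim (Localization.AtPrime p) := by
    rw [← h1]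
    exact le_add_of_nonneg_left ringKrullDim_nonneg_of_nontrivial
  exact h3.trans (ringKrullDim_le_of_isLocalization _ p.primeCompl)

end KrullDimension

namespace SComplex

variable {V : Type*} {K : Type*} [Field K]

section KrullDimension

/-- The projection to a polynomial ring in fewer variables. -/
noncomputable def projectVars [DecidableEq V] (F : Finset V) :
    MvPolynomial V K →+* MvPolynomial F K :=
  MvPolynomial.eval₂Hom MvPolynomial.C fun v => if h : v ∈ F then MvPolynomial.X ⟨v, h⟩ else 0

theorem projectVars_surjective [DecidableEq V] (F : Finset V) :
    Function.Surjective (projectVars (K := K) F) := by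
  intro f
  refine ⟨MvPolynomial.rename Subtype.val f, ?_⟩
  rw [projectVars, MvPolynomial.coe_eval₂Hom, MvPolynomial.eval₂_rename]
  convert MvPolynomial.eval₂_eta f using 2
  ext v : 1
  simp

theorem ringKrullDim_mvPolynomial_coe (F : Finset V) :
    ringKrullDim (MvPolynomial F K) = F.card := by
  rw [MvPolynomial.ringKrullDim_of_isNoetherianRing, ringKrullDim_eq_zero_of_field, zero_add]
  simp

theorem card_le_ringKrullDim {Γ : SComplex V} {F : Finset V} (hF : F ∈ Γ.faces) :
    (F.card : WithBot ℕ∞) ≤ ringKrullDim (Γ.StanleyReisnerRing K) := by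
  classical
  rw [← ringKrullDim_mvPolynomial_coe (K := K)]
  have hle : ∀ f ∈ Γ.stanleyReisnerIdeal K, projectVars F f = 0 := by
    have : Γ.stanleyReisnerIdeal K ≤ RingHom.ker (projectVars (K := K) F) := by
      refine Ideal.span_le.2 ?_
      rintro _ ⟨A, hA, rfl⟩
      obtain ⟨v, hv, hvF⟩ := Finset.not_subset.1 fun h => hA (Γ.down_closed hF h)
      rw [SetLike.mem_coe, RingHom.mem_ker, map_prod]
      refine Finset.prod_eq_zero hv ?_
      rw [projectVars, MvPolynomial.eval₂Hom_X', dif_neg hvF]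
    exact fun f hf => this hf
  exact ringKrullDim_le_of_surjective
    (Ideal.Quotient.lift _ (projectVars F) hle)
    (Ideal.Quotient.lift_surjective_of_surjective _ hle (projectVars_surjective F))

/-- A quotient of a polynomial ring in which all squarefree monomials of degree `r + 1` vanish
has dimension at most `r`. -/
theorem ringKrullDim_le_of_prod_X_eq_zero [Fintype V] {B : Type*} [CommRing B]
    (φ : MvPolynomial V K →+* B) (hφ : Function.Surjective φ) {r : ℕ}
    (h : ∀ A : Finset V, A.card = r + 1 → φ (∏ v ∈ A, MvPolynomial.X v) = 0) :
    ringKrullDim B ≤ r := by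
  classical
  refine iSup_le fun l => ?_
  -- The whole chain lives over its smallest prime `p`. At most `r` variables are nonzero modulo
  -- `p`, since any `r + 1` of them have product zero, so `B ⧸ p` is a quotient of a polynomial ring
  -- in at most `r` variables.
  set p := l.head with hp
  let F : Finset V := {v | φ (MvPolynomial.X v) ∉ p.asIdeal}
  have hF : F.card ≤ r := by
    by_contra! hc
    obtain ⟨A, hAF, hA⟩ := Finset.exists_subset_card_eq hc
    have h0 : ∏ v ∈ A, φ (MvPolynomial.X v) ∈ p.asIdeal := by
      rw [← map_prod, h A hA]
      exact zero_mem _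
    obtain ⟨v, hv, hvp⟩ := Ideal.IsPrime.prod_mem_iff.1 h0
    exact (Finset.mem_filter.1 (hAF hv)).2 hvp
  let ψ : MvPolynomial V K →+* B ⧸ p.asIdeal := (Ideal.Quotient.mk p.asIdeal).comp φ
  have hψ : Function.Surjective ψ := Ideal.Quotient.mk_surjective.comp hφ
  let g : MvPolynomial F K →+* B ⧸ p.asIdeal :=
    MvPolynomial.eval₂Hom (ψ.comp MvPolynomial.C) fun v => ψ (MvPolynomial.X v.1)
  have hg : g.comp (projectVars F) = ψ := by
    ext v
    · simp [g, projectVars]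
    · simp only [RingHom.comp_apply, projectVars, MvPolynomial.eval₂Hom_X']
      split_ifs with hv
      · simp [g]
      · rw [map_zero]
        symm
        refine Ideal.Quotient.eq_zero_iff_mem.2 ?_
        by_contra hc
        exact hv (Finset.mem_filter.2 ⟨Finset.mem_univ _, hc⟩)
  have hgs : Function.Surjective g := by
    refine Function.Surjective.of_comp (g := projectVars F) ?_
    rw [← RingHom.coe_comp, hg]
    exact hψ
  have h1 : ringKrullDim (B ⧸ p.asIdeal) ≤ r := by
    refine (ringKrullDim_le_of_surjective g hgs).trans ?_
    rw [ringKrullDim_mvPolynomial_coe]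
    exact_mod_cast hF
  refine le_trans ?_ h1
  rw [ringKrullDim_quotient]
  let l' : LTSeries (PrimeSpectrum.zeroLocus (R := B) p.asIdeal) :=
    { length := l.length
      toFun := fun i => ⟨l i, (show p ≤ l i from l.head_le i)⟩
      step := fun i => l.step i }
  exact le_iSup (fun s : LTSeries _ => (s.length : WithBot ℕ∞)) l'

end KrullDimension

/-! ### Depth and Cohen–Macaulayness of shellable complexes. -/

section Depth

open RingTheory.Sequence

/-- As `∅` is a face, no element of the Stanley–Reisner ideal has a constant term, and the
irrelevant ideal is the image of the kernel of the constant coefficient. -/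
theorem isPrime_irrelevantIdeal {Γ : SComplex V} (h : ∅ ∈ Γ.faces) :
    (Γ.irrelevantIdeal K).IsPrime ∧
      ∀ f : MvPolynomial V K, Ideal.Quotient.mk (Γ.stanleyReisnerIdeal K) f ∈
        Γ.irrelevantIdeal K ↔ MvPolynomial.constantCoeff f = 0 := by
  have hle : Γ.stanleyReisnerIdeal K ≤ RingHom.ker (MvPolynomial.constantCoeff (R := K)) := by
    intro f hf
    rw [mem_stanleyReisnerIdeal] at hf
    rw [RingHom.mem_ker, MvPolynomial.constantCoeff_eq]
    by_contra hc
    exact hf 0 (MvPolynomial.mem_support_iff.2 hc) (by simpa using h)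
  have hker : (RingHom.ker (MvPolynomial.constantCoeff (R := K) (σ := V))) =
      Ideal.span (Set.range MvPolynomial.X) := by
    ext f
    rw [← Set.image_univ, MvPolynomial.mem_ideal_span_X_image, RingHom.mem_ker,
      MvPolynomial.constantCoeff_eq]
    constructor
    · intro hf m hm
      by_contra! hc
      obtain rfl : m = 0 := Finsupp.ext fun v => hc v trivial
      exact MvPolynomial.mem_support_iff.1 hm hf
    · intro hf
      by_contra hc
      obtain ⟨v, -, hv⟩ := hf 0 (MvPolynomial.mem_support_iff.2 hc)
      exact hv rfl
  have hirr : Γ.irrelevantIdeal K = (RingHom.ker (MvPolynomial.constantCoeff (R := K))).map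
      (Ideal.Quotient.mk (Γ.stanleyReisnerIdeal K)) := by
    rw [hker, Ideal.map_span, irrelevantIdeal, ← Set.range_comp]
    rfl
  have hmem : ∀ f : MvPolynomial V K, Ideal.Quotient.mk (Γ.stanleyReisnerIdeal K) f ∈
        Γ.irrelevantIdeal K ↔ MvPolynomial.constantCoeff f = 0 := by
    intro f
    rw [hirr, ← Ideal.mem_comap, Ideal.comap_map_of_surjective _ Ideal.Quotient.mk_surjective,
      ← RingHom.ker_eq_comap_bot, Ideal.mk_ker, sup_eq_left.2 hle, RingHom.mem_ker]
  refine ⟨?_, hmem⟩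
  rw [hirr]
  have : (RingHom.ker (MvPolynomial.constantCoeff (R := K) (σ := V))).IsPrime :=
    RingHom.ker_isPrime _
  exact Ideal.map_isPrime_of_surjective Ideal.Quotient.mk_surjective (by rwa [Ideal.mk_ker])

/-- Regular sequences in the irrelevant ideal are at most as long as the dimension. -/
theorem length_le_of_isWeaklyRegular [Finite V] {Γ : SComplex V} (h : ∅ ∈ Γ.faces)
    {rs : List (Γ.StanleyReisnerRing K)} (hrs : ∀ r ∈ rs, r ∈ Γ.irrelevantIdeal K)
    (hreg : IsWeaklyRegular (Γ.StanleyReisnerRing K) rs) :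
    (rs.length : WithBot ℕ∞) ≤ ringKrullDim (Γ.StanleyReisnerRing K) := by
  have := (isPrime_irrelevantIdeal (K := K) h).1
  exact hreg.length_le_ringKrullDim_of_isPrime (Γ.irrelevantIdeal K) hrs

/-- A pure shellable complex is Cohen–Macaulay. -/
theorem PureShellable.isCohenMacaulay [Fintype V] {Γ : SComplex V} {k : ℕ}
    (hΓ : PureShellable k Γ) (hk : ∀ A ∈ Γ.faces, A.card ≤ k) (h0 : ∅ ∈ Γ.faces) :
    Γ.IsCohenMacaulay K := by
  classical
  have hdim : ringKrullDim (Γ.StanleyReisnerRing K) ≤ k :=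
    ringKrullDim_le_of_prod_X_eq_zero _ Ideal.Quotient.mk_surjective fun A hA =>
      Ideal.Quotient.eq_zero_iff_mem.2 (prod_X_mem_stanleyReisnerIdeal fun hc => by
        have := hk A hc
        lia)
  obtain ⟨hprime, hmem⟩ := isPrime_irrelevantIdeal (K := K) h0
  have hupper : ((Γ.depth K : ℕ∞) : WithBot ℕ∞) ≤ ringKrullDim (Γ.StanleyReisnerRing K) := by
    obtain ⟨d, hd⟩ : ∃ d : ℕ∞, (d : WithBot ℕ∞) = ringKrullDim (Γ.StanleyReisnerRing K) :=
      WithBot.ne_bot_iff_exists.1 (ne_bot_of_le_ne_bot (by simp) (card_le_ringKrullDim h0))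
    rw [← hd, WithBot.coe_le_coe]
    refine iSup_le fun rs => iSup_le fun hrs => iSup_le fun hreg => ?_
    have := length_le_of_isWeaklyRegular h0 hrs hreg.1
    rw [← hd] at this
    exact_mod_cast this
  refine le_antisymm hupper (hdim.trans ?_)
  let rs : List (Γ.StanleyReisnerRing K) :=
    (esymmList V K k).map (algebraMap (MvPolynomial V K) (Γ.StanleyReisnerRing K))
  have hrs : ∀ r ∈ rs, r ∈ Γ.irrelevantIdeal K := by
    intro r hr
    obtain ⟨f, hf, rfl⟩ := List.mem_map.1 hr
    obtain ⟨i, rfl⟩ := exists_eq_esymm_of_mem_esymmList V K k f hf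
    refine (hmem _).2 ?_
    rw [MvPolynomial.esymm, map_sum]
    refine Finset.sum_eq_zero fun A hA => ?_
    have hA' : A.Nonempty := Finset.card_pos.1 (by
      rw [(Finset.mem_powersetCard.1 hA).2]; lia)
    obtain ⟨v, hv⟩ := hA'
    rw [map_prod]
    exact Finset.prod_eq_zero hv (MvPolynomial.constantCoeff_X _ v)
  have hweak : IsWeaklyRegular (Γ.StanleyReisnerRing K) rs :=
    (isWeaklyRegular_map_algebraMap_iff _ _ _).2 (isWeaklyRegular_esymmList k hΓ)
  -- Beyond weak regularity only properness is needed: the sequence lies in the irrelevant ideal,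
  -- which is prime.
  have hreg : IsRegular (Γ.StanleyReisnerRing K) rs := by
    refine ⟨hweak, fun hc => hprime.ne_top (eq_top_iff.2 ?_)⟩
    have hle : Ideal.ofList rs ≤ Γ.irrelevantIdeal K := Ideal.span_le.2 hrs
    intro x _
    have hx : x ∈ Ideal.ofList rs • (⊤ : Ideal (Γ.StanleyReisnerRing K)) := by
      rw [← hc]
      trivial
    rw [smul_eq_mul, Ideal.mul_top] at hx
    exact hle hx
  have hlen : rs.length = k := by rw [List.length_map, length_esymmList]
  have : (k : ℕ∞) ≤ Γ.depth K := by
    refine le_trans ?_ (le_iSup _ rs)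
    refine le_trans ?_ (le_iSup _ hrs)
    refine le_trans ?_ (le_iSup _ hreg)
    rw [hlen]
  exact_mod_cast this

end Depth

end SComplex

/-! ### Depth drops when the facets separate in codimension two. -/

section Separation

open RingTheory.Sequence IsLocalRing

/-- If `J` kills a nonzero class modulo a regular element `a`, locally at a prime `p`, then the
depth of `p` is at most one more than the dimension of `R ⧸ J`. -/
theorem RingTheory.Sequence.IsWeaklyRegular.le_ringKrullDim_quotient_of_mul_mem {R : Type*}
    [CommRing R] [IsNoetherianRing R] {rs : List R} (hreg : IsWeaklyRegular R rs) (p : Ideal R)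
    [p.IsPrime] (hrs : ∀ r ∈ rs, r ∈ p) {n : ℕ} (hn : rs.length = n + 1) {a u : R} (ha : a ∈ p)
    (har : ∀ c, a * c = 0 → c = 0) (hu : ∀ s ∉ p, ∀ c, s * u ≠ a * c) {J : Ideal R}
    (hJ : ∀ g ∈ J, ∃ c, g * u = a * c) : (n : WithBot ℕ∞) ≤ ringKrullDim (R ⧸ J) := by
  let A := Localization.AtPrime p
  let φ : R →+* A := algebraMap R A
  have hmem : ∀ r ∈ p, φ r ∈ maximalIdeal A := fun r hr =>
    (IsLocalization.AtPrime.to_map_mem_maximal_iff A p r).2 hr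
  have hd : DepthGE (A := A) (n + 1) A := by
    refine ⟨rs.map φ, by rw [List.length_map, hn], ?_, hreg.of_isLocalization A p.primeCompl⟩
    intro r hr
    obtain ⟨r', hr', rfl⟩ := List.mem_map.1 hr
    exact hmem r' (hrs r' hr')
  have ha' : IsSMulRegular A (φ a) := by
    have h1 : IsWeaklyRegular R [a] := (isWeaklyRegular_singleton_iff R a).2
      (isSMulRegular_iff_right_eq_zero_of_smul.2 har)
    have h2 := h1.of_isLocalization A p.primeCompl
    exact (isWeaklyRegular_singleton_iff A (φ a)).1 h2
  let w : QuotSMulTop (φ a) A := Submodule.Quotient.mk (φ u)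
  have hw : ∀ y : A, (Submodule.Quotient.mk y : QuotSMulTop (φ a) A) = 0 ↔ ∃ t, φ a * t = y := by
    intro y
    rw [Submodule.Quotient.mk_eq_zero, Submodule.mem_smul_pointwise_iff_exists]
    simp
  have hw0 : w ≠ 0 := by
    intro h0
    obtain ⟨t, ht⟩ := (hw _).1 h0
    obtain ⟨⟨c, s⟩, hcs⟩ := IsLocalization.surj p.primeCompl t
    have h1 : φ (u * s) = φ (a * c) := by
      rw [map_mul, map_mul, ← ht, mul_assoc, hcs]
    obtain ⟨t', ht'⟩ := (IsLocalization.eq_iff_exists p.primeCompl A).1 h1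
    refine hu (t' * s) (p.primeCompl.mul_mem t'.2 s.2) (t' * c) ?_
    linear_combination ht'
  -- Passing to the quotient by `a` costs one of the `n + 1`; the remaining `n` is bounded by the
  -- dimension modulo the annihilator of the class of `u`, and the contraction of that annihilator
  -- contains `J`.
  have h1 := (hd.quotSMulTop (hmem a ha) ha').le_ringKrullDim_quotient_torsionOf hw0
  refine h1.trans ((ringKrullDim_quotient_le_comap p.primeCompl _).trans ?_)
  have hle : J ≤ (Ideal.torsionOf A (QuotSMulTop (φ a) A) w).comap (algebraMap R A) := by
    intro g hg
    obtain ⟨c, hc⟩ := hJ g hg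
    rw [Ideal.mem_comap, Ideal.mem_torsionOf_iff, ← Submodule.Quotient.mk_smul, hw]
    exact ⟨φ c, by rw [← map_mul, ← hc, map_mul]; rfl⟩
  exact ringKrullDim_le_of_surjective (Ideal.Quotient.factor hle)
    (Ideal.Quotient.factor_surjective hle)

namespace SComplex

variable {V : Type*} [Fintype V] [DecidableEq V] {K : Type*} [Field K]

/-- A pure complex whose facets fall into two classes that meet in codimension at least two has
depth less than its dimension plus one. -/
theorem length_lt_of_separated {k : ℕ} {𝓕₁ 𝓕₂ : Finset (Finset V)}
    (h₁ : ∀ F ∈ 𝓕₁, F.card = k) (h₂ : ∀ F ∈ 𝓕₂, F.card = k) (hne₁ : 𝓕₁.Nonempty)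
    (hne₂ : 𝓕₂.Nonempty) (hsep : ∀ F ∈ 𝓕₁, ∀ F' ∈ 𝓕₂, (F ∩ F').card + 2 ≤ k)
    {Γ : SComplex V} (hΓ : Γ = generatedBy {F | F ∈ 𝓕₁ ∨ F ∈ 𝓕₂})
    {rs : List (Γ.StanleyReisnerRing K)} (hrs : ∀ r ∈ rs, r ∈ Γ.irrelevantIdeal K)
    (hreg : IsWeaklyRegular (Γ.StanleyReisnerRing K) rs) : rs.length < k := by
  obtain ⟨E₁, hE₁⟩ := hne₁
  obtain ⟨E₂, hE₂⟩ := hne₂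
  have hk : 2 ≤ k := by have := hsep E₁ hE₁ E₂ hE₂; lia
  have hdisj : Disjoint 𝓕₁ 𝓕₂ := Finset.disjoint_left.2 fun F hF hF' => by
    have := hsep F hF F hF'
    rw [Finset.inter_self, h₁ F hF] at this
    lia
  have h0 : ∅ ∈ Γ.faces := by
    rw [hΓ]
    exact ⟨E₁, .inl hE₁, by simp⟩
  obtain ⟨hprime, hmem⟩ := isPrime_irrelevantIdeal (K := K) h0
  have hI : ∀ f : MvPolynomial V K, f ∈ Γ.stanleyReisnerIdeal K ↔
      ∀ F, F ∈ 𝓕₁ ∨ F ∈ 𝓕₂ → restrictVars F f = 0 := by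
    intro f
    rw [hΓ, mem_stanleyReisnerIdeal_of_generatedBy]
    rfl
  let x : Finset V → MvPolynomial V K := fun F => ∏ v ∈ F, MvPolynomial.X v
  -- Since all facets have `k` elements, restriction to a facet `F` of the first class sends `a₁` to
  -- the monomial of `F` and `a₂` to `0`; the second class behaves symmetrically. Hence `a₁ + a₂`
  -- restricts to a nonzero monomial on every facet.
  let a₁ : MvPolynomial V K := ∑ F ∈ 𝓕₁, x F
  let a₂ : MvPolynomial V K := ∑ F ∈ 𝓕₂, x F
  have hres : ∀ F : Finset V, F.card = k → ∀ 𝓕 : Finset (Finset V), (∀ F ∈ 𝓕, F.card = k) →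
      restrictVars F (∑ A ∈ 𝓕, x A) = if F ∈ 𝓕 then x F else 0 := by
    intro F hF 𝓕 h𝓕
    have : ∀ A ∈ 𝓕, restrictVars F (x A) = if F = A then x A else 0 := by
      intro A hA
      rw [restrictVars_prod_X]
      refine if_congr ⟨fun h => ?_, fun h => h ▸ subset_rfl⟩ rfl rfl
      exact (Finset.eq_of_subset_of_card_le h (by rw [hF, h𝓕 A hA])).symm
    rw [map_sum, Finset.sum_congr rfl this, Finset.sum_ite_eq]
  have hr11 : ∀ F ∈ 𝓕₁, restrictVars F a₁ = x F := fun F hF => by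
    rw [hres F (h₁ F hF) 𝓕₁ h₁, if_pos hF]
  have hr12 : ∀ F ∈ 𝓕₁, restrictVars F a₂ = 0 := fun F hF => by
    rw [hres F (h₁ F hF) 𝓕₂ h₂, if_neg (Finset.disjoint_left.1 hdisj hF)]
  have hr21 : ∀ F ∈ 𝓕₂, restrictVars F a₁ = 0 := fun F hF => by
    rw [hres F (h₂ F hF) 𝓕₁ h₁, if_neg (Finset.disjoint_right.1 hdisj hF)]
  have hr22 : ∀ F ∈ 𝓕₂, restrictVars F a₂ = x F := fun F hF => by
    rw [hres F (h₂ F hF) 𝓕₂ h₂, if_pos hF]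
  let q : MvPolynomial V K →+* Γ.StanleyReisnerRing K := Ideal.Quotient.mk _
  have hq : Function.Surjective q := Ideal.Quotient.mk_surjective
  have hq0 : ∀ f, q f = 0 ↔ ∀ F, F ∈ 𝓕₁ ∨ F ∈ 𝓕₂ → restrictVars F f = 0 := fun f => by
    rw [← hI]
    exact Ideal.Quotient.eq_zero_iff_mem
  have hqeq : ∀ f g, q f = q g ↔
      ∀ F, F ∈ 𝓕₁ ∨ F ∈ 𝓕₂ → restrictVars F f = restrictVars F g := fun f g => by
    rw [← sub_eq_zero, ← map_sub, hq0]
    simp only [map_sub, sub_eq_zero]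
  by_contra! hlt
  obtain ⟨n, hn⟩ : ∃ n, rs.length = n + 1 := ⟨rs.length - 1, by lia⟩
  -- A set of `k - 1` elements cannot lie in facets of both classes, as these share at most `k - 2`.
  -- So its monomial times `a₁` is either zero or that monomial times `a₁ + a₂`.
  let J : Ideal (Γ.StanleyReisnerRing K) :=
    Ideal.span {f | ∃ A : Finset V, A.card = k - 1 ∧ f = q (x A)}
  have hdimJ : ringKrullDim (Γ.StanleyReisnerRing K ⧸ J) ≤ (k - 2 : ℕ) := by
    let φ : MvPolynomial V K →+* Γ.StanleyReisnerRing K ⧸ J := (Ideal.Quotient.mk J).comp q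
    have hφ : Function.Surjective φ := Ideal.Quotient.mk_surjective.comp hq
    refine ringKrullDim_le_of_prod_X_eq_zero (K := K) (V := V) (B := Γ.StanleyReisnerRing K ⧸ J) φ
      hφ fun A hA => ?_
    exact Ideal.Quotient.eq_zero_iff_mem.2 (Ideal.subset_span ⟨A, by lia, rfl⟩)
  have hconst : ∀ (F : Finset V) (f : MvPolynomial V K),
      MvPolynomial.constantCoeff (restrictVars F f) = MvPolynomial.constantCoeff f := by
    intro F f
    rw [MvPolynomial.constantCoeff_eq, coeff_restrictVars, if_pos (by simp)]
  have hmain := hreg.le_ringKrullDim_quotient_of_mul_mem (Γ.irrelevantIdeal K) hrs hn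
    (a := q (a₁ + a₂)) (u := q a₁) (J := J) ?_ ?_ ?_ ?_
  · have := hmain.trans hdimJ
    have : n ≤ k - 2 := by exact_mod_cast this
    lia
  · refine (hmem _).2 ?_
    rw [← hconst E₁, map_add, hr11 E₁ hE₁, hr12 E₁ hE₁, add_zero, map_prod]
    obtain ⟨v, hv⟩ := Finset.card_pos.1 (show 0 < E₁.card by rw [h₁ E₁ hE₁]; lia)
    exact Finset.prod_eq_zero hv (MvPolynomial.constantCoeff_X _ v)
  · intro c hc
    obtain ⟨c, rfl⟩ := hq c
    rw [← map_mul, hq0] at hc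
    rw [hq0]
    rintro F hF
    have := hc F hF
    rw [map_mul, map_add] at this
    refine (mul_eq_zero.1 this).resolve_left ?_
    rcases hF with hF | hF
    · rw [hr11 F hF, hr12 F hF, add_zero]
      exact prod_X_ne_zero F
    · rw [hr21 F hF, hr22 F hF, zero_add]
      exact prod_X_ne_zero F
  -- If `s a₁ = (a₁ + a₂) c`, then `c` agrees with `s` on `E₁` and vanishes on `E₂`. Comparing
  -- constant terms puts `s` into the irrelevant ideal.
  · intro s hs c h
    obtain ⟨c, rfl⟩ := hq c
    obtain ⟨s, rfl⟩ := hq s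
    rw [← map_mul, ← map_mul, hqeq] at h
    have e₁ := h E₁ (.inl hE₁)
    have e₂ := h E₂ (.inr hE₂)
    rw [map_mul, map_mul, map_add, hr11 E₁ hE₁, hr12 E₁ hE₁, add_zero, mul_comm] at e₁
    rw [map_mul, map_mul, map_add, hr21 E₂ hE₂, hr22 E₂ hE₂, zero_add, mul_zero] at e₂
    have e₁' := mul_left_cancel₀ (prod_X_ne_zero E₁) e₁
    have e₂' := (mul_eq_zero.1 e₂.symm).resolve_left (prod_X_ne_zero E₂)
    refine hs ((hmem s).2 ?_)
    rw [← hconst E₁, e₁', hconst, ← hconst E₂, e₂', map_zero]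
  · intro g hg
    refine Submodule.span_induction (p := fun g _ => ∃ c, g * q a₁ = q (a₁ + a₂) * c)
      ?_ ⟨0, by simp⟩ ?_ ?_ hg
    · rintro _ ⟨A, hA, rfl⟩
      by_cases hA₁ : ∃ F ∈ 𝓕₁, A ⊆ F
      · refine ⟨q (x A), ?_⟩
        rw [← map_mul, ← map_mul, hqeq]
        rintro F (hF | hF)
        · rw [map_mul, map_mul, map_add, hr12 F hF, add_zero, mul_comm]
        · obtain ⟨F', hF', hAF'⟩ := hA₁
          have hAF : ¬A ⊆ F := fun hc => by
            have h3 := hsep F' hF' F hF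
            have h4 := Finset.card_le_card (Finset.subset_inter hAF' hc)
            lia
          have : restrictVars F (x A) = 0 := by rw [restrictVars_prod_X, if_neg hAF]
          rw [map_mul, map_mul, this, zero_mul, mul_zero]
      · refine ⟨0, ?_⟩
        rw [mul_zero, ← map_mul, hq0]
        rintro F (hF | hF)
        · rw [map_mul, restrictVars_prod_X, if_neg fun hc => hA₁ ⟨F, hF, hc⟩, zero_mul]
        · rw [map_mul, hr21 F hF, mul_zero]
    · rintro f g _ _ ⟨c, hc⟩ ⟨d, hd⟩
      exact ⟨c + d, by rw [add_mul, hc, hd, mul_add]⟩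
    · rintro r f _ ⟨c, hc⟩
      exact ⟨r * c, by rw [smul_eq_mul, mul_assoc, hc]; ring⟩

end SComplex

end Separation

/-! ### Chordal graphs and simplicial vertices. -/

namespace SimpleGraph

variable {V : Type*}

/-- The graph on the same vertices with those edges that lie inside `T`. -/
def restrict (H : SimpleGraph V) (T : Set V) : SimpleGraph V where
  Adj x y := H.Adj x y ∧ x ∈ T ∧ y ∈ T
  symm := ⟨fun _ _ h => ⟨h.1.symm, h.2.2, h.2.1⟩⟩
  loopless := ⟨fun _ h => H.loopless.irrefl _ h.1⟩

theorem restrict_le (H : SimpleGraph V) (T : Set V) : H.restrict T ≤ H := fun _ _ h => h.1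

theorem restrict_mono (H : SimpleGraph V) {S T : Set V} (h : S ⊆ T) :
    H.restrict S ≤ H.restrict T := fun _ _ ha => ⟨ha.1, h ha.2.1, h ha.2.2⟩

theorem mem_of_mem_support_restrict {H : SimpleGraph V} {T : Set V} {x y : V}
    (p : (H.restrict T).Walk x y) (hx : x ∈ T) : ∀ z ∈ p.support, z ∈ T := by
  induction p with
  | nil => simpa using hx
  | cons h p ih =>
    intro z hz
    rw [Walk.support_cons, List.mem_cons] at hz
    exact hz.elim (fun e => e ▸ hx) (ih h.2.2 z)

/-- A shortest walk passes through every edge between two of its vertices. -/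
theorem Walk.mem_edges_of_length_eq_dist {H : SimpleGraph V} {s t : V} (p : H.Walk s t)
    (hp : p.length = H.dist s t) {x y : V} (hx : x ∈ p.support) (hy : y ∈ p.support)
    (h : H.Adj x y) : s(x, y) ∈ p.edges := by
  obtain ⟨i, rfl, hi⟩ := Walk.mem_support_iff_exists_getVert.1 hx
  obtain ⟨j, rfl, hj⟩ := Walk.mem_support_iff_exists_getVert.1 hy
  have key : ∀ i j, i ≤ p.length → j ≤ p.length → i < j → H.Adj (p.getVert i) (p.getVert j) →
      s(p.getVert i, p.getVert j) ∈ p.edges := by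
    intro i j hi hj hij h
    -- Replacing the stretch from `i` to `j` by the edge must not shorten the walk, which forces `j
    -- = i + 1`.
    have h1 := H.dist_le ((p.take i).append (Walk.cons h (p.drop j)))
    rw [Walk.length_append, Walk.length_cons, Walk.take_length, Walk.drop_length, ← hp,
      min_eq_left hi] at h1
    obtain rfl : j = i + 1 := by lia
    exact p.mk_mem_edges_iff_exists.2 ⟨i, by lia, rfl⟩
  rcases lt_trichotomy i j with hij | rfl | hij
  · exact key i j hi hj hij h
  · exact absurd rfl h.ne
  · rw [Sym2.eq_swap]
    exact key j i hj hi hij h.symm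

/-- In a chordal graph, two neighbours of `b` that are joined by a path avoiding the closed
neighbourhood of `b` are adjacent. -/
theorem ChordalGraph.adj_of_reachable {H : SimpleGraph V} (hH : H.ChordalGraph) {b s t : V}
    {U : Set V} (hU : ∀ x ∈ U, x ≠ b ∧ ¬H.Adj b x) (hs : H.Adj b s) (ht : H.Adj b t)
    (hne : s ≠ t) (hr : (H.restrict (U ∪ {s, t})).Reachable s t) : H.Adj s t := by
  by_contra hst
  -- A shortest path from `s` to `t` closes up through `b` to a cycle of length at least four. A
  -- chord at `b` is excluded because the inner vertices lie in `U`, and a chord of the path by its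
  -- minimal length.
  obtain ⟨p, hp⟩ := hr.exists_walk_length_eq_dist
  have hpath := p.isPath_of_length_eq_dist hp
  have hsup := mem_of_mem_support_restrict p (by simp)
  have hb : b ∉ p.support := by
    intro hb
    rcases hsup b hb with h | h | h
    · exact (hU b h).1 rfl
    · exact hs.ne h
    · exact ht.ne h
  have hlen : 2 ≤ p.length := by
    have h0 : p.length ≠ 0 := fun h => hne (Walk.eq_of_length_eq_zero h)
    have h1 : p.length ≠ 1 := fun h => hst (Walk.adj_of_length_eq_one h).1
    lia
  let p' := p.mapLe (H.restrict_le (U ∪ {s, t}))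
  have hs' : p'.support = p.support := Walk.support_mapLe_eq_support _ _
  have he' : p'.edges = p.edges := Walk.edges_mapLe_eq_edges _ _
  have hpath' : p'.IsPath := (Walk.isPath_mapLe _).2 hpath
  let c : H.Walk b b := Walk.cons hs (p'.concat ht.symm)
  have hcyc : c.IsCycle := by
    rw [Walk.cons_isCycle_iff]
    refine ⟨hpath'.concat (by rwa [hs']) _, ?_⟩
    rw [Walk.edges_concat, List.concat_eq_append, List.mem_append, he']
    rintro (h | h)
    · exact hb (Walk.fst_mem_support_of_mem_edges _ h)
    · rw [List.mem_singleton, Sym2.eq_swap, Sym2.congr_left] at h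
      exact hne h
  have hcl : 4 ≤ c.length := by
    rw [Walk.length_cons, Walk.length_concat, Walk.length_mapLe]
    lia
  have hedges : ∀ e, e ∈ c.edges ↔ e = s(b, s) ∨ e ∈ p.edges ∨ e = s(t, b) := by
    intro e
    rw [Walk.edges_cons, List.mem_cons, Walk.edges_concat, List.concat_eq_append,
      List.mem_append, he', List.mem_singleton]
  have hsupp : ∀ z ∈ c.support, z = b ∨ z ∈ p.support := by
    intro z hz
    rw [Walk.support_cons, List.mem_cons, Walk.support_concat,
      List.mem_append, hs', List.mem_singleton] at hz
    tauto
  obtain ⟨x, hx, y, hy, hxy, hnot⟩ := hH b c hcyc hcl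
  have hbcase : ∀ z ∈ p.support, H.Adj b z → s(b, z) ∈ c.edges := by
    intro z hz hbz
    rw [hedges]
    rcases hsup z hz with h | rfl | rfl
    · exact absurd hbz (hU z h).2
    · exact .inl rfl
    · exact .inr (.inr Sym2.eq_swap)
  rcases hsupp x hx with rfl | hx'
  · rcases hsupp y hy with rfl | hy'
    · exact hxy.ne rfl
    · exact hnot (hbcase y hy' hxy)
  · rcases hsupp y hy with rfl | hy'
    · exact hnot (Sym2.eq_swap ▸ hbcase x hx' hxy.symm)
    · exact hnot ((hedges _).2 (.inr (.inl (p.mem_edges_of_length_eq_dist hp hx' hy'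
        ⟨hxy, hsup x hx', hsup y hy'⟩))))

/-- The neighbours of `v` in `W` are pairwise adjacent. -/
def IsSimplicialIn (H : SimpleGraph V) (W : Finset V) (v : V) : Prop :=
  ∀ x ∈ W, ∀ y ∈ W, H.Adj v x → H.Adj v y → x ≠ y → H.Adj x y

/-- A form of Dirac's theorem: in a chordal graph, for every vertex that is not adjacent to all
others there is a simplicial vertex not adjacent to it. -/
theorem ChordalGraph.exists_isSimplicialIn {H : SimpleGraph V} (hH : H.ChordalGraph)
    (W : Finset V) : ∀ a ∈ W, ∀ b ∈ W, a ≠ b → ¬H.Adj b a →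
      ∃ v ∈ W, v ≠ b ∧ ¬H.Adj b v ∧ H.IsSimplicialIn W v := by
  classical
  induction W using Finset.strongInduction with
  | H W ih =>
    intro a ha b hb hab hba
    let U : Set V := {x | x ∈ W ∧ x ≠ b ∧ ¬H.Adj b x}
    have haU : a ∈ U := ⟨ha, hab, hba⟩
    -- `A` is the component of `a` among the vertices other than `b` not adjacent to `b`, and `S`
    -- its outer boundary. `S` consists of neighbours of `b` joined through `A`, so it is a clique.
    let A : Finset V := W.filter fun x => x ∈ U ∧ (H.restrict U).Reachable a x
    let S : Finset V := W.filter fun s => s ∉ A ∧ ∃ x ∈ A, H.Adj x s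
    have hA : ∀ x, x ∈ A ↔ x ∈ U ∧ (H.restrict U).Reachable a x := fun x =>
      ⟨fun h => (Finset.mem_filter.1 h).2, fun h => Finset.mem_filter.2 ⟨h.1.1, h⟩⟩
    have haA : a ∈ A := (hA a).2 ⟨haU, .refl a⟩
    have hSb : ∀ s ∈ S, H.Adj b s := by
      intro s hs
      obtain ⟨hsW, hsA, x, hx, hxs⟩ := Finset.mem_filter.1 hs
      obtain ⟨hxU, hxr⟩ := (hA x).1 hx
      by_contra hbs
      have hsb : s ≠ b := by
        rintro rfl
        exact hxU.2.2 hxs.symm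
      have hsU : s ∈ U := ⟨hsW, hsb, hbs⟩
      exact hsA ((hA s).2 ⟨hsU, hxr.trans (Adj.reachable ⟨hxs, hxU, hsU⟩)⟩)
    have hSclique : ∀ s ∈ S, ∀ t ∈ S, s ≠ t → H.Adj s t := by
      intro s hs t ht hst
      obtain ⟨-, -, x, hx, hxs⟩ := Finset.mem_filter.1 hs
      obtain ⟨-, -, y, hy, hyt⟩ := Finset.mem_filter.1 ht
      obtain ⟨hxU, hxr⟩ := (hA x).1 hx
      obtain ⟨hyU, hyr⟩ := (hA y).1 hy
      refine hH.adj_of_reachable (fun z hz => hz.2) (hSb s hs) (hSb t ht) hst (U := U) ?_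
      have h1 : (H.restrict (U ∪ {s, t})).Reachable x y :=
        (hxr.symm.trans hyr).mono (H.restrict_mono Set.subset_union_left)
      have h2 : (H.restrict (U ∪ {s, t})).Adj s x := ⟨hxs.symm, by simp, .inl hxU⟩
      have h3 : (H.restrict (U ∪ {s, t})).Adj y t := ⟨hyt, .inl hyU, by simp⟩
      exact h2.reachable.trans (h1.trans h3.reachable)
    have hAS : ∀ v ∈ A, ∀ x ∈ W, H.Adj v x → x ∈ A ∪ S := by
      intro v hv x hx hvx
      by_cases hxA : x ∈ A
      · exact Finset.mem_union_left _ hxA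
      · exact Finset.mem_union_right _ (Finset.mem_filter.2 ⟨hx, hxA, v, hv, hvx⟩)
    have hsub : A ∪ S ⊂ W := by
      refine (Finset.ssubset_iff_of_subset (Finset.union_subset (Finset.filter_subset _ _)
        (Finset.filter_subset _ _))).2 ⟨b, hb, fun h => ?_⟩
      rcases Finset.mem_union.1 h with h | h
      · exact ((hA b).1 h).1.2.1 rfl
      · exact (hSb b h).ne rfl
    -- All neighbours in `W` of a vertex of `A` lie in `A ∪ S`, a set without `b`, so the induction
    -- hypothesis applies there. It remains to keep the simplicial vertex out of `S`.
    suffices ∃ v ∈ A, H.IsSimplicialIn (A ∪ S) v by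
      obtain ⟨v, hv, hsimp⟩ := this
      obtain ⟨hvU, -⟩ := (hA v).1 hv
      exact ⟨v, hvU.1, hvU.2.1, hvU.2.2, fun x hx y hy hvx hvy =>
        hsimp x (hAS v hv x hx hvx) y (hAS v hv y hy hvy) hvx hvy⟩
    -- A vertex not adjacent to `s ∈ S` is outside the clique `S`. If every `s ∈ S` is adjacent to
    -- all others, a vertex not adjacent to some `x ∈ A` is outside `S`. If no such `x` exists
    -- either, `A ∪ S` is a clique.
    by_cases hS : ∃ s ∈ S, ∃ y ∈ A ∪ S, y ≠ s ∧ ¬H.Adj s y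
    · obtain ⟨s, hs, y, hy, hys, hsy⟩ := hS
      obtain ⟨v, hv, hvs, hsv, hsimp⟩ := ih _ hsub y hy s (Finset.mem_union_right _ hs) hys hsy
      refine ⟨v, (Finset.mem_union.1 hv).resolve_right fun hvS => ?_, hsimp⟩
      exact hsv (hSclique s hs v hvS hvs.symm)
    · push Not at hS
      by_cases hc : ∃ x ∈ A, ∃ y ∈ A ∪ S, y ≠ x ∧ ¬H.Adj x y
      · obtain ⟨x, hx, y, hy, hyx, hxy⟩ := hc
        obtain ⟨v, hv, hvx, hxv, hsimp⟩ := ih _ hsub y hy x (Finset.mem_union_left _ hx) hyx hxy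
        refine ⟨v, (Finset.mem_union.1 hv).resolve_right fun hvS => ?_, hsimp⟩
        exact hxv (hS v hvS x (Finset.mem_union_left _ hx) hvx.symm).symm
      · push Not at hc
        refine ⟨a, haA, fun x hx y hy _ _ hxy => ?_⟩
        rcases Finset.mem_union.1 hx with hx | hx
        · exact hc x hx y hy hxy.symm
        · exact hS x hx y hy hxy.symm

end SimpleGraph

theorem reflTransGen_map {α β : Type*} {r : α → α → Prop} {s : β → β → Prop} (f : α → β)
    (h : ∀ a b, r a b → Relation.ReflTransGen s (f a) (f b)) {a b : α}
    (hab : Relation.ReflTransGen r a b) : Relation.ReflTransGen s (f a) (f b) :=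
  Relation.ReflTransGen.lift' f (fun a b => h a b) a b hab

/-! ### Initial dimension, and weak connectedness as a necessary condition. -/

namespace SComplex

variable {V : Type*}

section InitialDimension

theorem mdim_le_of_isFacet {Δ : SComplex V} {F : Finset V} (h : Δ.IsFacet F) :
    Δ.mdim ≤ (F.card : ℤ) - 1 := by
  have : sInf {n : ℕ | ∃ F, Δ.IsFacet F ∧ F.card = n} ≤ F.card := Nat.sInf_le ⟨F, h, rfl⟩
  rw [mdim]
  lia

theorem mdim_eq_of_isFacet {Δ : SComplex V} {C : Finset V} (hC : Δ.IsFacet C)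
    (h : ∀ F, Δ.IsFacet F → C.card ≤ F.card) : Δ.mdim = (C.card : ℤ) - 1 := by
  refine le_antisymm (mdim_le_of_isFacet hC) ?_
  have : C.card ≤ sInf {n : ℕ | ∃ F, Δ.IsFacet F ∧ F.card = n} :=
    le_csInf ⟨_, C, hC, rfl⟩ (by rintro _ ⟨F, hF, rfl⟩; exact h F hF)
  rw [mdim]
  lia

variable [Finite V]

theorem exists_isFacet_ge {Δ : SComplex V} {F : Finset V} (h : F ∈ Δ.faces) :
    ∃ G, Δ.IsFacet G ∧ F ⊆ G := by
  obtain ⟨G, hFG, hG⟩ := (Set.toFinite {A | A ∈ Δ.faces}).exists_le_maximal h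
  exact ⟨G, hG, hFG⟩

theorem exists_isFacet_card_eq {Δ : SComplex V} {F : Finset V} (h : F ∈ Δ.faces) :
    ∃ C, Δ.IsFacet C ∧ (∀ F, Δ.IsFacet F → C.card ≤ F.card) ∧ Δ.mdim = (C.card : ℤ) - 1 := by
  obtain ⟨G, hG, -⟩ := exists_isFacet_ge h
  obtain ⟨C, hC, hcard⟩ := Nat.sInf_mem (s := {n : ℕ | ∃ F, Δ.IsFacet F ∧ F.card = n})
    ⟨_, G, hG, rfl⟩
  have hmin : ∀ F, Δ.IsFacet F → C.card ≤ F.card := fun F hF =>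
    hcard ▸ Nat.sInf_le ⟨F, hF, rfl⟩
  exact ⟨C, hC, hmin, mdim_eq_of_isFacet hC hmin⟩

theorem le_mdim {Δ : SComplex V} {F : Finset V} (h : F ∈ Δ.faces) {n : ℤ}
    (hn : ∀ F, Δ.IsFacet F → n ≤ (F.card : ℤ) - 1) : n ≤ Δ.mdim := by
  obtain ⟨C, hC, -, hmd⟩ := exists_isFacet_card_eq h
  rw [hmd]
  exact hn C hC

end InitialDimension

theorem isFacet_simplex_iff {F A : Finset V} : (simplex F).IsFacet A ↔ A = F := by
  simp only [IsFacet, mem_simplex_faces]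
  exact ⟨fun h => (h.eq_of_ge subset_rfl h.1).symm, fun h => h ▸ ⟨subset_rfl, fun _ hB _ => hB⟩⟩

section WeaklyConnected

variable [DecidableEq V]

theorem symm_weaklyConnected_step {Δ : SComplex V} :
    Std.Symm fun F F' => Δ.IsFacet F ∧ Δ.IsFacet F' ∧ Δ.mdim ≤ ((F ∩ F').card : ℤ) :=
  ⟨fun _ _ ⟨h1, h2, h3⟩ => ⟨h2, h1, by rwa [Finset.inter_comm]⟩⟩

variable [Finite V]

/-- A facet of the intersection of `⟨F j⟩` with the earlier simplices lies in a single `F i` and has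
at least `mdim Δ` elements. So each facet is one step from an earlier one, and all are joined to `F
0`. -/
theorem Scalable.weaklyConnected {Δ : SComplex V} (h : Δ.Scalable) : Δ.WeaklyConnected := by
  obtain ⟨q, F, -, hF, hscal⟩ := h
  let r := fun F F' => Δ.IsFacet F ∧ Δ.IsFacet F' ∧ Δ.mdim ≤ ((F ∩ F').card : ℤ)
  have hfacet : ∀ j, Δ.IsFacet (F j) := fun j => (hF _).2 ⟨j, rfl⟩
  have hprev : ∀ j : Fin q, 0 < (j : ℕ) → ∃ i < j, Δ.mdim ≤ ((F i ∩ F j).card : ℤ) := by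
    intro j hj
    have h0 : ∅ ∈ ((simplex (F j)).inter (generatedBy {A | ∃ i, i < j ∧ F i = A})).faces :=
      ⟨mem_simplex_faces.2 (by simp), F ⟨0, by lia⟩, ⟨⟨0, by lia⟩, hj, rfl⟩, by simp⟩
    obtain ⟨C, hC, -, hmd⟩ := exists_isFacet_card_eq h0
    have hle := hscal j hj
    rw [hmd] at hle
    obtain ⟨hCj, _, ⟨i, hij, rfl⟩, hCi⟩ := hC.1
    refine ⟨i, hij, ?_⟩
    have := Finset.card_le_card (Finset.subset_inter hCi (mem_simplex_faces.1 hCj))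
    lia
  have hzero : ∀ (n : ℕ) (hn : n < q), Relation.ReflTransGen r (F ⟨0, by lia⟩) (F ⟨n, hn⟩) := by
    intro n
    induction n using Nat.strong_induction_on with
    | _ n ih =>
      intro hn
      rcases Nat.eq_zero_or_pos n with rfl | hpos
      · exact .refl
      · obtain ⟨i, hi, hmd⟩ := hprev ⟨n, hn⟩ hpos
        exact (ih i hi i.2).tail ⟨hfacet _, hfacet _, hmd⟩
  have : Std.Symm r := symm_weaklyConnected_step
  intro A B hA hB
  obtain ⟨i, rfl⟩ := (hF A).1 hA
  obtain ⟨j, rfl⟩ := (hF B).1 hB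
  exact (symm (hzero i i.2)).trans (hzero j j.2)

/-- Chains in the deletion lift by enlarging each member to a facet of `Δ`, chains in the link by
inserting `x`; it remains to pass from facets with `x` to facets without. -/
theorem VertexDismissible.weaklyConnected {Δ : SComplex V} (h : Δ.VertexDismissible) :
    Δ.WeaklyConnected := by
  induction h with
  | of_simplex F =>
    intro A B hA hB
    rw [isFacet_simplex_iff] at hA hB
    rw [hA, hB]
  | of_dismissing Δ x hx _ _ ihdel ihlink =>
    obtain ⟨hxΔ, hmd⟩ := hx
    let r := fun F F' => Δ.IsFacet F ∧ Δ.IsFacet F' ∧ Δ.mdim ≤ ((F ∩ F').card : ℤ)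
    have : Std.Symm r := symm_weaklyConnected_step
    have hlink : ∀ A, Δ.IsFacet A → x ∈ A → (Δ.link x).IsFacet (A.erase x) := by
      intro A hA hxA
      refine ⟨⟨A, hA.1, hxA, rfl⟩, ?_⟩
      rintro _ ⟨B, hB, hxB, rfl⟩ hle
      have hAB : A ⊆ B := fun y hy => by
        by_cases hyx : y = x
        · exact hyx ▸ hxB
        · exact Finset.mem_of_mem_erase (hle (Finset.mem_erase.2 ⟨hyx, hy⟩))
      exact Finset.erase_subset_erase x (hA.2 hB hAB)
    have hlink' : ∀ A, (Δ.link x).IsFacet A → x ∉ A ∧ Δ.IsFacet (insert x A) := by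
      rintro _ ⟨⟨A, hA, hxA, rfl⟩, hmax⟩
      refine ⟨by simp, ?_⟩
      rw [Finset.insert_erase hxA]
      refine ⟨hA, fun B hB hAB => ?_⟩
      have := hmax ⟨B, hB, hAB hxA, rfl⟩ (Finset.erase_subset_erase x hAB)
      intro y hy
      by_cases hyx : y = x
      · exact hyx ▸ hxA
      · exact Finset.mem_of_mem_erase (this (Finset.mem_erase.2 ⟨hyx, hy⟩))
    -- Consecutive facets in the link may share one vertex less than required, which inserting `x`
    -- restores.
    have hlinkmd : Δ.mdim - 1 ≤ (Δ.link x).mdim := by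
      refine le_mdim (F := ∅) (Δ := Δ.link x) ⟨{x}, hxΔ, by simp, by simp⟩ fun F hF => ?_
      have h1 := mdim_le_of_isFacet (hlink' F hF).2
      rw [Finset.card_insert_of_notMem (hlink' F hF).1] at h1
      push_cast at h1
      lia
    have hdelΔ : ∀ A, (Δ.deletion x).IsFacet A → ∃ B, Δ.IsFacet B ∧ A ⊆ B := fun A hA =>
      exists_isFacet_ge hA.1.1
    have hclose : ∀ A B D E, Δ.IsFacet D → Δ.IsFacet E → A ⊆ D → B ⊆ E →
        Δ.mdim ≤ ((A ∩ B).card : ℤ) → r D E := by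
      intro A B D E hD hE hAD hBE hle
      refine ⟨hD, hE, hle.trans ?_⟩
      exact_mod_cast Finset.card_le_card (Finset.inter_subset_inter hAD hBE)
    have hself : ∀ A, (Δ.deletion x).IsFacet A → Δ.mdim ≤ ((A ∩ A).card : ℤ) := by
      intro A hA
      have := mdim_le_of_isFacet hA
      rw [Finset.inter_self]
      lia
    have hdel : ∀ A B, (Δ.deletion x).IsFacet A → (Δ.deletion x).IsFacet B →
        ∀ D E, Δ.IsFacet D → Δ.IsFacet E → A ⊆ D → B ⊆ E → Relation.ReflTransGen r D E := by
      intro A B hA hB D E hD hE hAD hBE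
      have hchain := ihdel A B hA hB
      induction hchain generalizing E with
      | refl => exact .single (hclose A A D E hD hE hAD hBE (hself A hA))
      | tail _ hstep ih =>
        obtain ⟨h1, h2, h3⟩ := hstep
        obtain ⟨E', hE', hsub⟩ := hdelΔ _ h1
        exact (ih h1 E' hE' hsub).tail (hclose _ _ E' E hE' hE hsub hBE (hmd.trans h3))
    have hlk : ∀ A B, Δ.IsFacet A → Δ.IsFacet B → x ∈ A → x ∈ B →
        Relation.ReflTransGen r A B := by
      intro A B hA hB hxA hxB
      have hchain := ihlink _ _ (hlink A hA hxA) (hlink B hB hxB)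
      have := reflTransGen_map (s := r) (insert x) (fun F F' ⟨h1, h2, h3⟩ => by
        refine .single ⟨(hlink' F h1).2, (hlink' F' h2).2, ?_⟩
        rw [← Finset.insert_inter_distrib, Finset.card_insert_of_notMem
          (fun hc => (hlink' F h1).1 (Finset.mem_of_mem_inter_left hc))]
        push_cast
        lia) hchain
      rwa [Finset.insert_erase hxA, Finset.insert_erase hxB] at this
    have hndel : ∀ A, Δ.IsFacet A → x ∉ A → (Δ.deletion x).IsFacet A := fun A hA hxA =>
      ⟨⟨hA.1, hxA⟩, fun B hB hAB => hA.2 hB.1 hAB⟩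
    have hcross : ∀ A B, Δ.IsFacet A → Δ.IsFacet B → x ∈ A → x ∉ B →
        Relation.ReflTransGen r A B := by
      intro A B hA hB hxA hxB
      -- The bridge: `A.erase x` lies in a facet of the deletion, hence in a facet `E` of `Δ`, and
      -- `A` and `E` share at least `|A| - 1 ≥ mdim Δ` vertices.
      obtain ⟨G, hG, hAG⟩ := exists_isFacet_ge (Δ := Δ.deletion x) (F := A.erase x)
        ⟨Δ.down_closed hA.1 (Finset.erase_subset _ _), by simp⟩
      obtain ⟨E, hE, hGE⟩ := hdelΔ G hG
      refine .head (hclose (A.erase x) (A.erase x) A E hA hE (Finset.erase_subset _ _)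
        (hAG.trans hGE) ?_) (hdel G B hG (hndel B hB hxB) E B hE hB hGE subset_rfl)
      have h1 := mdim_le_of_isFacet hA
      rw [Finset.inter_self, Finset.card_erase_of_mem hxA]
      have := Finset.card_pos.2 ⟨x, hxA⟩
      push_cast [Nat.cast_sub this]
      lia
    intro A B hA hB
    by_cases hxA : x ∈ A <;> by_cases hxB : x ∈ B
    · exact hlk A B hA hB hxA hxB
    · exact hcross A B hA hB hxA hxB
    · exact symm (hcross B A hB hA hxB hxA)
    · exact hdel A B (hndel A hA hxA) (hndel B hB hxB) A B hA hB subset_rfl subset_rfl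

end WeaklyConnected

/-- A face with at most `|C|` elements extends to one with exactly `|C|`, since every facet is at
least that large. -/
theorem mem_pureSkeleton_mdim_iff [Finite V] {Δ : SComplex V} {C : Finset V}
    (hmin : ∀ F, Δ.IsFacet F → C.card ≤ F.card) (hmd : Δ.mdim = (C.card : ℤ) - 1)
    {A : Finset V} : A ∈ (Δ.pureSkeleton Δ.mdim).faces ↔ A ∈ Δ.faces ∧ A.card ≤ C.card := by
  constructor
  · rintro ⟨B, ⟨hB, hdim⟩, hAB⟩
    rw [faceDim, hmd] at hdim
    have := Finset.card_le_card hAB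
    exact ⟨Δ.down_closed hB hAB, by lia⟩
  · rintro ⟨hA, hcard⟩
    obtain ⟨G, hG, hAG⟩ := exists_isFacet_ge hA
    obtain ⟨B, hAB, hBG, hB⟩ := Finset.exists_subsuperset_card_eq hAG hcard (hmin G hG)
    exact ⟨B, ⟨Δ.down_closed hG.1 hBG, by rw [faceDim, hmd, hB]⟩, hAB⟩

/-- An initially Cohen–Macaulay complex is weakly connected. -/
theorem IsInitiallyCohenMacaulay.weaklyConnected [Fintype V] [DecidableEq V] {K : Type*}
    [Field K] {Δ : SComplex V} (h : Δ.IsInitiallyCohenMacaulay K) : Δ.WeaklyConnected := by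
  classical
  intro A B hA hB
  let r := fun F F' => Δ.IsFacet F ∧ Δ.IsFacet F' ∧ Δ.mdim ≤ ((F ∩ F').card : ℤ)
  by_contra hAB
  obtain ⟨C, hC, hmin, hmd⟩ := exists_isFacet_card_eq hA.1
  -- The faces of size `|C|` are divided by whether they lie in a facet reachable from `A`. Faces
  -- sharing at least `|C| - 1` vertices lie in facets one step apart, so different classes meet in
  -- at most `|C| - 2`.
  let P : Finset V → Prop := fun F => ∃ G, Δ.IsFacet G ∧ F ⊆ G ∧ Relation.ReflTransGen r A G
  let 𝓕 : Finset (Finset V) := {F | F ∈ Δ.faces ∧ F.card = C.card}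
  have h𝓕 : ∀ F, F ∈ 𝓕 ↔ F ∈ Δ.faces ∧ F.card = C.card := fun F => by simp [𝓕]
  have hΓ : Δ.pureSkeleton Δ.mdim =
      generatedBy {F | F ∈ 𝓕.filter P ∨ F ∈ 𝓕.filter fun F => ¬P F} := by
    rw [pureSkeleton]
    congr 1
    ext F
    simp only [Set.mem_ofPred_eq, Finset.mem_filter, h𝓕, faceDim, hmd]
    constructor
    · rintro ⟨h1, h2⟩
      have : F.card = C.card := by lia
      by_cases hP : P F
      · exact .inl ⟨⟨h1, this⟩, hP⟩
      · exact .inr ⟨⟨h1, this⟩, hP⟩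
    · rintro (⟨⟨h1, h2⟩, -⟩ | ⟨⟨h1, h2⟩, -⟩) <;> exact ⟨h1, by rw [h2]⟩
  have hstep : ∀ F F' G G', Δ.IsFacet G → Δ.IsFacet G' → F ⊆ G → F' ⊆ G' →
      C.card ≤ (F ∩ F').card + 1 → r G G' := by
    intro F F' G G' hG hG' hFG hFG' hle
    refine ⟨hG, hG', ?_⟩
    have := Finset.card_le_card (Finset.inter_subset_inter hFG hFG')
    rw [hmd]
    lia
  have hlen := fun rs hrs hreg => length_lt_of_separated (K := K) (k := C.card)
    (𝓕₁ := 𝓕.filter P) (𝓕₂ := 𝓕.filter fun F => ¬P F)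
    (fun F hF => ((h𝓕 F).1 (Finset.mem_filter.1 hF).1).2)
    (fun F hF => ((h𝓕 F).1 (Finset.mem_filter.1 hF).1).2) ?_ ?_ ?_ hΓ (rs := rs) hrs hreg
  -- The empty sequence already shows `0 < |C|`, so `C.card - 1` below is not truncated.
  · have hpos : 0 < C.card := by simpa using hlen [] (by simp) (.nil _ _)
    have hdepth : (Δ.pureSkeleton Δ.mdim).depth K ≤ (C.card - 1 : ℕ) := by
      refine iSup_le fun rs => iSup_le fun hrs => iSup_le fun hreg => ?_
      have := hlen rs hrs hreg.1
      exact_mod_cast (by lia : rs.length ≤ C.card - 1)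
    have hdim := card_le_ringKrullDim (K := K) (Γ := Δ.pureSkeleton Δ.mdim) (F := C)
      ((mem_pureSkeleton_mdim_iff hmin hmd).2 ⟨hC.1, le_rfl⟩)
    rw [← show _ = _ from h] at hdim
    have h1 : (C.card : ℕ∞) ≤ (Δ.pureSkeleton Δ.mdim).depth K := by exact_mod_cast hdim
    have h2 : C.card ≤ C.card - 1 := by exact_mod_cast h1.trans hdepth
    lia
  · obtain ⟨F, hFA, hF⟩ := Finset.exists_subset_card_eq (hmin A hA)
    exact ⟨F, Finset.mem_filter.2 ⟨(h𝓕 F).2 ⟨Δ.down_closed hA.1 hFA, hF⟩, A, hA, hFA, .refl⟩⟩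
  · obtain ⟨F, hFB, hF⟩ := Finset.exists_subset_card_eq (hmin B hB)
    refine ⟨F, Finset.mem_filter.2 ⟨(h𝓕 F).2 ⟨Δ.down_closed hB.1 hFB, hF⟩, ?_⟩⟩
    rintro ⟨G, hG, hFG, hAG⟩
    exact hAB (hAG.tail (hstep F F G B hG hB hFG hFB (by rw [Finset.inter_self]; lia)))
  · intro F hF F' hF'
    obtain ⟨-, G, hG, hFG, hAG⟩ := Finset.mem_filter.1 hF
    obtain ⟨hF'1, hF'2⟩ := Finset.mem_filter.1 hF'
    by_contra hlt
    obtain ⟨G', hG', hFG'⟩ := exists_isFacet_ge ((h𝓕 F').1 hF'1).1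
    exact hF'2 ⟨G', hG', hFG', hAG.tail (hstep F F' G G' hG hG' hFG hFG' (by lia))⟩

end SComplex

/-- A chain may begin with stationary steps; the first other step leaves `a`. -/
theorem exists_ne_of_reflTransGen {α : Type*} {r : α → α → Prop} {a b : α}
    (h : Relation.ReflTransGen r a b) (hne : a ≠ b) : ∃ c, c ≠ a ∧ r a c := by
  induction h using Relation.ReflTransGen.head_induction_on with
  | refl => exact absurd rfl hne
  | @head a c hac _ ih =>
    by_cases hca : c = a
    · subst hca
      exact ih hne
    · exact ⟨c, hca, hac⟩

/-! ### Clique complexes built by adding vertices with clique neighbourhoods. -/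

namespace SimpleGraph

variable {V : Type*}

/-- The complex of cliques inside `W`. -/
def cliqueComplexIn (H : SimpleGraph V) (W : Finset V) : SComplex V where
  faces := {F | F ⊆ W ∧ H.IsClique F}
  down_closed := fun _ _ hF hGF => ⟨hGF.trans hF.1, hF.2.subset (Finset.coe_subset.2 hGF)⟩

theorem indepComplex_eq_cliqueComplexIn [Fintype V] (G : SimpleGraph V) :
    G.indepComplex = Gᶜ.cliqueComplexIn Finset.univ := by
  ext F
  change G.IsIndepSet F ↔ F ⊆ Finset.univ ∧ Gᶜ.IsClique F
  rw [isClique_compl]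
  simp

/-- The graphs induced on vertex sets `W` which are obtained from a clique `C` by successively
adding vertices whose earlier neighbours form a clique on at least `|C| - 1` vertices that does
not contain `C`. -/
inductive CliqueBuild [DecidableEq V] (H : SimpleGraph V) (C : Finset V) : Finset V → Prop
  | base (hC : H.IsClique C) : CliqueBuild H C C
  | add (W N : Finset V) (v : V) (hv : v ∉ W) (hNW : N ⊆ W) (hN : H.IsClique N)
      (hadj : ∀ x ∈ W, H.Adj v x ↔ x ∈ N) (hcard : C.card ≤ N.card + 1) (hCN : ¬C ⊆ N)
      (h : CliqueBuild H C W) : CliqueBuild H C (insert v W)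

section AddVertex

variable [DecidableEq V] {H : SimpleGraph V} {W N : Finset V} {v : V}

theorem mem_cliqueComplexIn_insert (hNW : N ⊆ W) (hN : H.IsClique N)
    (hadj : ∀ x ∈ W, H.Adj v x ↔ x ∈ N) {A : Finset V} :
    A ∈ (H.cliqueComplexIn (insert v W)).faces ↔
      A ∈ (H.cliqueComplexIn W).faces ∨ (v ∈ A ∧ A ⊆ insert v N) := by
  constructor
  · rintro ⟨hAW, hA⟩
    by_cases hvA : v ∈ A
    · refine .inr ⟨hvA, fun x hx => ?_⟩
      by_cases hxv : x = v
      · exact hxv ▸ Finset.mem_insert_self _ _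
      · have hxW : x ∈ W := (Finset.mem_insert.1 (hAW hx)).resolve_left hxv
        exact Finset.mem_insert_of_mem ((hadj x hxW).1 (hA hvA hx (Ne.symm hxv)))
    · exact .inl ⟨(Finset.subset_insert_iff_of_notMem hvA).1 hAW, hA⟩
  · rintro (⟨hAW, hA⟩ | ⟨-, hA⟩)
    · exact ⟨hAW.trans (Finset.subset_insert _ _), hA⟩
    · refine ⟨hA.trans (Finset.insert_subset_insert v hNW), ?_⟩
      refine IsClique.subset (Finset.coe_subset.2 hA) ?_
      rw [Finset.coe_insert, isClique_insert]
      exact ⟨hN, fun x hx _ => (hadj x (hNW hx)).2 hx⟩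

/-- All new faces lie in `insert v N`, so it is the only new facet, and the only old facet it can
swallow is `N`. -/
theorem isFacet_cliqueComplexIn_insert (hv : v ∉ W) (hNW : N ⊆ W) (hN : H.IsClique N)
    (hadj : ∀ x ∈ W, H.Adj v x ↔ x ∈ N) {A : Finset V} :
    (H.cliqueComplexIn (insert v W)).IsFacet A ↔
      A = insert v N ∨ ((H.cliqueComplexIn W).IsFacet A ∧ A ≠ N) := by
  have hmem := fun A => mem_cliqueComplexIn_insert hNW hN hadj (A := A)
  have hvN : v ∉ N := fun h => hv (hNW h)
  constructor
  · rintro ⟨hA, hmax⟩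
    rcases (hmem A).1 hA with h | ⟨hvA, h⟩
    · refine .inr ⟨⟨h, fun B hB hAB => hmax ((hmem B).2 (.inl hB)) hAB⟩, ?_⟩
      rintro rfl
      have := hmax ((hmem (insert v A)).2 (.inr ⟨by simp, subset_rfl⟩)) (Finset.subset_insert _ _)
      exact hvN (this (Finset.mem_insert_self _ _))
    · exact .inl (h.antisymm (hmax ((hmem _).2 (.inr ⟨by simp, subset_rfl⟩)) h))
  · rintro (rfl | ⟨hA, hAN⟩)
    · refine ⟨(hmem _).2 (.inr ⟨by simp, subset_rfl⟩), fun B hB hle => ?_⟩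
      rcases (hmem B).1 hB with h | ⟨-, h⟩
      · exact absurd (h.1 (hle (Finset.mem_insert_self _ _))) hv
      · exact h
    · refine ⟨(hmem A).2 (.inl hA.1), fun B hB hAB => ?_⟩
      rcases (hmem B).1 hB with h | ⟨-, h⟩
      · exact hA.2 h hAB
      · have hvA : v ∉ A := fun h => hv (hA.1.1 h)
        have hA' : A ⊆ N := (Finset.subset_insert_iff_of_notMem hvA).1 (hAB.trans h)
        exact absurd (hA'.antisymm (hA.2 ⟨hNW, hN⟩ hA')) hAN

theorem deletion_cliqueComplexIn_insert (hv : v ∉ W) :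
    (H.cliqueComplexIn (insert v W)).deletion v = H.cliqueComplexIn W := by
  ext A
  constructor
  · rintro ⟨⟨hA, hcl⟩, hvA⟩
    exact ⟨(Finset.subset_insert_iff_of_notMem hvA).1 hA, hcl⟩
  · rintro ⟨hA, hcl⟩
    exact ⟨⟨hA.trans (Finset.subset_insert _ _), hcl⟩, fun h => hv (hA h)⟩

theorem link_cliqueComplexIn_insert (hv : v ∉ W) (hNW : N ⊆ W) (hN : H.IsClique N)
    (hadj : ∀ x ∈ W, H.Adj v x ↔ x ∈ N) :
    (H.cliqueComplexIn (insert v W)).link v = SComplex.simplex N := by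
  ext A
  rw [SComplex.mem_simplex_faces]
  constructor
  · rintro ⟨B, hB, hvB, rfl⟩
    rcases (mem_cliqueComplexIn_insert hNW hN hadj).1 hB with h | ⟨-, h⟩
    · exact absurd (h.1 hvB) hv
    · rwa [← Finset.subset_insert_iff]
  · intro hA
    have hvA : v ∉ A := fun h => hv (hNW (hA h))
    exact ⟨insert v A, (mem_cliqueComplexIn_insert hNW hN hadj).2
      (.inr ⟨by simp, Finset.insert_subset_insert v hA⟩), by simp, (Finset.erase_insert hvA).symm⟩

end AddVertex

theorem cliqueComplexIn_of_isClique {H : SimpleGraph V} {C : Finset V} (hC : H.IsClique C) :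
    H.cliqueComplexIn C = SComplex.simplex C := by
  ext A
  rw [SComplex.mem_simplex_faces]
  exact ⟨fun h => h.1, fun h => ⟨h, hC.subset (Finset.coe_subset.2 h)⟩⟩

namespace CliqueBuild

variable [DecidableEq V] {H : SimpleGraph V} {C W : Finset V}

/-- `¬C ⊆ N` prevents `C` from being swallowed, and `|N| + 1 ≥ |C|` keeps the new facet from being
smaller. Thus `mdim` stays constant throughout the construction. -/
theorem isFacet (h : CliqueBuild H C W) : (H.cliqueComplexIn W).IsFacet C ∧
    ∀ F, (H.cliqueComplexIn W).IsFacet F → C.card ≤ F.card := by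
  induction h with
  | base hC =>
    rw [cliqueComplexIn_of_isClique hC]
    simp [SComplex.isFacet_simplex_iff]
  | add W N v hv hNW hN hadj hcard hCN h ih =>
    refine ⟨(isFacet_cliqueComplexIn_insert hv hNW hN hadj).2
      (.inr ⟨ih.1, fun h => hCN h.le⟩), fun F hF => ?_⟩
    rcases (isFacet_cliqueComplexIn_insert hv hNW hN hadj).1 hF with rfl | hF
    · rwa [Finset.card_insert_of_notMem fun h => hv (hNW h)]
    · exact ih.2 F hF.1

theorem mdim_eq (h : CliqueBuild H C W) : (H.cliqueComplexIn W).mdim = (C.card : ℤ) - 1 :=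
  SComplex.mdim_eq_of_isFacet h.isFacet.1 h.isFacet.2

/-- The vertex added last is dismissing: its deletion is the previous stage, with the same `mdim`,
and its link is the simplex on `N`. -/
theorem vertexDismissible (h : CliqueBuild H C W) :
    (H.cliqueComplexIn W).VertexDismissible := by
  induction h with
  | base hC =>
    rw [cliqueComplexIn_of_isClique hC]
    exact .of_simplex C
  | add W N v hv hNW hN hadj hcard hCN h ih =>
    have hmd := (CliqueBuild.add W N v hv hNW hN hadj hcard hCN h).mdim_eq
    refine .of_dismissing _ v ⟨(mem_cliqueComplexIn_insert hNW hN hadj).2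
      (.inr ⟨by simp, by simp⟩), ?_⟩ ?_ ?_
    · rw [deletion_cliqueComplexIn_insert hv, h.mdim_eq, hmd]
    · rwa [deletion_cliqueComplexIn_insert hv]
    · rw [link_cliqueComplexIn_insert hv hNW hN hadj]
      exact .of_simplex N

/-- Adding `v` enlarges the pure skeleton by the faces `{v} ∪ B` with `B ⊆ N` and `|B| ≤ |C| - 1`,
which is the situation of `attach_skeleton` with `S = {v}`. -/
theorem pureShellable [Finite V] (h : CliqueBuild H C W) : SComplex.PureShellable C.card
    ((H.cliqueComplexIn W).pureSkeleton (H.cliqueComplexIn W).mdim) := by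
  induction h with
  | base hC =>
    have hmd := (CliqueBuild.base hC).mdim_eq
    have hmin := (CliqueBuild.base hC).isFacet.2
    convert SComplex.PureShellable.of_simplex C rfl
    ext A
    rw [SComplex.mem_pureSkeleton_mdim_iff hmin hmd, cliqueComplexIn_of_isClique hC,
      SComplex.mem_simplex_faces]
    exact ⟨fun h => h.1, fun h => ⟨h, Finset.card_le_card h⟩⟩
  | add W N v hv hNW hN hadj hcard hCN h ih =>
    have h' := CliqueBuild.add W N v hv hNW hN hadj hcard hCN h
    have hmem := fun A => SComplex.mem_pureSkeleton_mdim_iff h.isFacet.2 h.mdim_eq (A := A)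
    have hmem' := fun A => SComplex.mem_pureSkeleton_mdim_iff h'.isFacet.2 h'.mdim_eq (A := A)
    have hpos : 0 < C.card := by
      rw [Finset.card_pos, Finset.nonempty_iff_ne_empty]
      rintro rfl
      exact hCN (by simp)
    have hvN : v ∉ N := fun h => hv (hNW h)
    have hins : N ∪ {v} = insert v N := by rw [Finset.union_comm, Finset.insert_eq]
    have hcardA : ∀ A : Finset V, v ∈ A → A ⊆ insert v N → A.card = (A ∩ N).card + 1 := by
      intro A hvA hA
      have : A = insert v (A ∩ N) := by
        ext x
        constructor
        · intro hx
          rcases Finset.mem_insert.1 (hA hx) with rfl | hxN <;> simp_all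
        · intro hx
          rcases Finset.mem_insert.1 hx with rfl | hx
          · exact hvA
          · exact Finset.mem_of_mem_inter_left hx
      conv_lhs => rw [this]
      rw [Finset.card_insert_of_notMem (by simp [hvN])]
    refine ih.attach_skeleton N {v} (C.card - 1) _ _ (by simpa using hvN) (by lia)
      (by rw [Finset.card_singleton]; lia) ?_ ?_
    · intro A hA hAN
      rw [hmem, Finset.singleton_subset_iff]
      refine ⟨fun h hvA => hv (h.1.1 hvA), fun hvA => ?_⟩
      rw [hins, Finset.subset_insert_iff_of_notMem hvA] at hA
      rw [Finset.inter_eq_left.2 hA] at hAN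
      exact ⟨⟨hA.trans hNW, hN.subset (Finset.coe_subset.2 hA)⟩, by lia⟩
    · intro A
      rw [hmem, hmem', Finset.singleton_subset_iff, hins,
        mem_cliqueComplexIn_insert hNW hN hadj]
      constructor
      · rintro ⟨h1 | ⟨h1, h2⟩, h3⟩
        · exact .inl ⟨h1, h3⟩
        · exact .inr ⟨h1, h2, by have := hcardA A h1 h2; lia⟩
      · rintro (⟨h1, h2⟩ | ⟨h1, h2, h3⟩)
        · exact ⟨.inl h1, h2⟩
        · exact ⟨.inr ⟨h1, h2⟩, by have := hcardA A h1 h2; lia⟩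

end CliqueBuild

end SimpleGraph

/-! ### Elimination of simplicial vertices, scaling orders and the equivalences. -/

namespace SimpleGraph

variable {V : Type*} [DecidableEq V] {H : SimpleGraph V}

/-- Weak connectedness allows to eliminate simplicial vertices one at a time until only a
smallest facet is left. -/
theorem ChordalGraph.cliqueBuild [Finite V] (hH : H.ChordalGraph) (C : Finset V) (W : Finset V) :
    (H.cliqueComplexIn W).IsFacet C →
    (∀ F, (H.cliqueComplexIn W).IsFacet F → C.card ≤ F.card) →
    (∀ A B, (H.cliqueComplexIn W).IsFacet A → (H.cliqueComplexIn W).IsFacet B →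
      Relation.ReflTransGen (fun F F' => (H.cliqueComplexIn W).IsFacet F ∧
        (H.cliqueComplexIn W).IsFacet F' ∧ C.card ≤ (F ∩ F').card + 1) A B) →
    CliqueBuild H C W := by
  induction W using Finset.strongInduction with
  | H W ih =>
    intro hC hmin hconn
    by_cases hCW : W ⊆ C
    · obtain rfl : C = W := hC.1.1.antisymm hCW
      exact .base hC.1.2
    obtain ⟨w, hwW, hwC⟩ := Finset.not_subset.1 hCW
    -- `C` is a maximal clique. Choosing the simplicial vertex not adjacent to this `b` ensures both
    -- `v ∉ C` and `¬C ⊆ N`.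
    obtain ⟨b, hbC, hbw⟩ : ∃ b ∈ C, ¬H.Adj b w := by
      by_contra! hc
      refine hwC (hC.2 (y := insert w C) ⟨Finset.insert_subset hwW hC.1.1, ?_⟩
        (Finset.subset_insert _ _) (Finset.mem_insert_self _ _))
      rw [Finset.coe_insert, isClique_insert]
      exact ⟨hC.1.2, fun x hx _ => (hc x hx).symm⟩
    obtain ⟨v, hvW, hvb, hbv, hsimp⟩ := hH.exists_isSimplicialIn W w hwW b (hC.1.1 hbC)
      (fun h => hwC (h ▸ hbC)) hbw
    classical
    let N : Finset V := W.filter fun x => H.Adj v x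
    have hNmem : ∀ x, x ∈ N ↔ x ∈ W ∧ H.Adj v x := fun x => Finset.mem_filter
    obtain ⟨W', hvW', hWW'⟩ : ∃ W', v ∉ W' ∧ insert v W' = W :=
      ⟨W.erase v, by simp, Finset.insert_erase hvW⟩
    have hNW' : N ⊆ W' := fun x hx => by
      obtain ⟨h1, h2⟩ := (hNmem x).1 hx
      rw [← hWW'] at h1
      exact (Finset.mem_insert.1 h1).resolve_left h2.ne'
    have hNcl : H.IsClique N := fun x hx y hy hxy =>
      hsimp x ((hNmem x).1 hx).1 y ((hNmem y).1 hy).1 ((hNmem x).1 hx).2 ((hNmem y).1 hy).2 hxy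
    have hadj : ∀ x ∈ W', H.Adj v x ↔ x ∈ N := fun x hx => by
      rw [hNmem, ← hWW']
      exact ⟨fun h => ⟨Finset.mem_insert_of_mem hx, h⟩, fun h => h.2⟩
    have hvC : v ∉ C := fun h => hbv (hC.1.2 hbC h (Ne.symm hvb))
    have hCN : ¬C ⊆ N := fun h => hbv ((hNmem b).1 (h hbC)).2.symm
    have hvN : v ∉ N := fun h => hvW' (hNW' h)
    have hss : W' ⊂ W := by
      rw [← hWW']
      exact Finset.ssubset_insert hvW'
    have hfacet : ∀ A, (H.cliqueComplexIn W).IsFacet A ↔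
        A = insert v N ∨ ((H.cliqueComplexIn W').IsFacet A ∧ A ≠ N) := fun A => by
      rw [← hWW']
      exact isFacet_cliqueComplexIn_insert hvW' hNW' hNcl hadj
    have hvfacet : ∀ A, (H.cliqueComplexIn W).IsFacet A → A ≠ insert v N → v ∉ A := by
      intro A hA hne hvA
      exact hvW' ((((hfacet A).1 hA).resolve_left hne).1.1.1 hvA)
    have hNfacet : (H.cliqueComplexIn W).IsFacet (insert v N) := (hfacet _).2 (.inl rfl)
    have hcardN := hmin _ hNfacet
    rw [Finset.card_insert_of_notMem hvN] at hcardN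
    have hC' : (H.cliqueComplexIn W').IsFacet C :=
      (((hfacet C).1 hC).resolve_left fun h => hvC (h ▸ Finset.mem_insert_self _ _)).1
    rw [← hWW']
    refine .add W' N v hvW' hNW' hNcl hadj hcardN hCN (ih W' hss hC' ?_ ?_)
    · intro F hF
      by_cases hFN : F = N
      · subst hFN
        by_contra hlt
        -- If `|N| < |C|`, the first facet `F` that a chain from `insert v N` to `C` moves to shares
        -- at least `|C| - 1 ≥ |N|` vertices with it. As `v ∉ F`, this forces `N ⊆ F`, although `N`
        -- is a facet of the smaller complex and `F ≠ N`.
        obtain ⟨F, hne, -, hF', hle⟩ := exists_ne_of_reflTransGen (hconn _ C hNfacet hC)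
          fun h => hvC (h ▸ Finset.mem_insert_self _ _)
        have hvF := hvfacet F hF' hne
        rw [Finset.insert_inter_of_notMem hvF] at hle
        have hNF : N ⊆ F := Finset.inter_eq_left.1
          (Finset.eq_of_subset_of_card_le Finset.inter_subset_left (by lia))
        obtain ⟨hF1, hF2⟩ := ((hfacet F).1 hF').resolve_left hne
        exact hF2 ((hF.2 hF1.1 hNF).antisymm hNF)
      · exact hmin F ((hfacet F).2 (.inr ⟨hF, hFN⟩))
    · obtain ⟨D, hD, hND⟩ := SComplex.exists_isFacet_ge (Δ := H.cliqueComplexIn W')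
        (F := N) ⟨hNW', hNcl⟩
      -- Chains are transported by replacing `insert v N` with a facet `D` containing `N`. Only one
      -- facet contains `v`, so distinct facets share no `v` and their intersection does not shrink.
      let φ : Finset V → Finset V := fun F => if v ∈ F then D else F
      have hφ : ∀ F, (H.cliqueComplexIn W).IsFacet F → (H.cliqueComplexIn W').IsFacet (φ F) ∧
          ∀ x ∈ F, x ≠ v → x ∈ φ F := by
        intro F hF
        rcases (hfacet F).1 hF with rfl | ⟨h1, h2⟩
        · simp only [φ, Finset.mem_insert_self, if_true]
          exact ⟨hD, fun x hx hxv => hND ((Finset.mem_insert.1 hx).resolve_left hxv)⟩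
        · have hvF : v ∉ F := fun h => hvW' (h1.1.1 h)
          simp only [φ, hvF, if_false]
          exact ⟨h1, fun x hx _ => hx⟩
      have hsurj : ∀ A, (H.cliqueComplexIn W').IsFacet A →
          ∃ A', (H.cliqueComplexIn W).IsFacet A' ∧ φ A' = A := by
        intro A hA
        have hvA : v ∉ A := fun h => hvW' (hA.1.1 h)
        by_cases hAN : A = N
        · refine ⟨insert v N, hNfacet, ?_⟩
          simp only [φ, Finset.mem_insert_self, if_true]
          subst hAN
          exact (hA.2 hD.1 hND).antisymm hND
        · exact ⟨A, (hfacet A).2 (.inr ⟨hA, hAN⟩), if_neg hvA⟩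
      intro A B hA hB
      obtain ⟨A', hA', rfl⟩ := hsurj A hA
      obtain ⟨B', hB', rfl⟩ := hsurj B hB
      refine reflTransGen_map φ (fun F F' ⟨h1, h2, h3⟩ => ?_) (hconn A' B' hA' hB')
      by_cases hFF' : F = F'
      · rw [hFF']
      · refine .single ⟨(hφ F h1).1, (hφ F' h2).1, h3.trans (Nat.add_le_add_right ?_ 1)⟩
        refine Finset.card_le_card fun x hx => ?_
        obtain ⟨hxF, hxF'⟩ := Finset.mem_inter.1 hx
        have hxv : x ≠ v := by
          rintro rfl
          by_cases hF : F = insert x N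
          · exact hvfacet F' h2 (fun h => hFF' (hF.trans h.symm)) hxF'
          · exact hvfacet F h1 hF hxF
        exact Finset.mem_inter.2 ⟨(hφ F h1).2 x hxF hxv, (hφ F' h2).2 x hxF' hxv⟩

/-- Each member of the list meets every later one inside some later one which it meets in at
least `k - 1` elements. -/
def IsScalingList (k : ℕ) : List (Finset V) → Prop
  | [] => True
  | F :: l => IsScalingList k l ∧ ∀ B ∈ l, ∃ D ∈ l, F ∩ B ⊆ D ∧ k ≤ (F ∩ D).card + 1

theorem IsScalingList.getElem {k : ℕ} {l : List (Finset V)} (h : IsScalingList k l) :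
    ∀ (i j : ℕ) (hij : i < j) (hj : j < l.length), ∃ (m : ℕ) (_ : i < m) (hm : m < l.length),
      l[i] ∩ l[j] ⊆ l[m] ∧ k ≤ (l[i] ∩ l[m]).card + 1 := by
  induction l with
  | nil => exact fun i j _ hj => absurd hj (by simp)
  | cons F l ih =>
    intro i j hij hj
    obtain ⟨j, rfl⟩ : ∃ j', j = j' + 1 := ⟨j - 1, by lia⟩
    rw [List.length_cons] at hj
    rcases i with _ | i
    · obtain ⟨D, hD, h1, h2⟩ := h.2 l[j] (List.getElem_mem _)
      obtain ⟨m, hm, rfl⟩ := List.getElem_of_mem hD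
      exact ⟨m + 1, by lia, by rw [List.length_cons]; lia, h1, h2⟩
    · obtain ⟨m, h1, h2, h3, h4⟩ := ih h.1 i j (by lia) (by lia)
      exact ⟨m + 1, by lia, by rw [List.length_cons]; lia, h3, h4⟩

/-- The list runs opposite to the scaling order, hence `Fin.rev`. A facet of the intersection
complex lies in some `l[j] ∩ l[m]` with at least `k - 1` elements; that set is itself a face, so
maximality bounds the facet from below. -/
theorem IsScalingList.scalable [Finite V] {Δ : SComplex V} {k : ℕ} {l : List (Finset V)}
    (h : IsScalingList k l) (hnd : l.Nodup) (hl : ∀ A, Δ.IsFacet A ↔ A ∈ l)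
    (hk : Δ.mdim = (k : ℤ) - 1) : Δ.Scalable := by
  refine ⟨l.length, fun i => l.get i.rev, fun i j hij => ?_, fun A => ?_, fun j hj => ?_⟩
  · exact Fin.rev_injective (List.nodup_iff_injective_get.1 hnd hij)
  · rw [hl, List.mem_iff_get]
    exact ⟨fun ⟨i, hi⟩ => ⟨i.rev, by simpa using hi⟩, fun ⟨i, hi⟩ => ⟨i.rev, hi⟩⟩
  · rw [hk]
    have h0 : ∅ ∈ ((SComplex.simplex (l.get j.rev)).inter
        (SComplex.generatedBy {A | ∃ i, i < j ∧ l.get i.rev = A})).faces :=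
      ⟨SComplex.mem_simplex_faces.2 (by simp), _, ⟨⟨0, by lia⟩, hj, rfl⟩, by simp⟩
    refine SComplex.le_mdim h0 fun A hA => ?_
    obtain ⟨hAj, _, ⟨i, hij, rfl⟩, hAi⟩ := hA.1
    rw [SComplex.mem_simplex_faces] at hAj
    obtain ⟨m, hm, hm', h1, h2⟩ := h.getElem j.rev i.rev (Fin.rev_lt_rev.2 hij) i.rev.2
    have hle : A ⊆ l.get j.rev ∩ l.get ⟨m, hm'⟩ :=
      Finset.subset_inter hAj ((Finset.subset_inter hAj hAi).trans h1)
    have hmem : l.get j.rev ∩ l.get ⟨m, hm'⟩ ∈ ((SComplex.simplex (l.get j.rev)).inter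
        (SComplex.generatedBy {A | ∃ i, i < j ∧ l.get i.rev = A})).faces := by
      refine ⟨SComplex.mem_simplex_faces.2 Finset.inter_subset_left, _,
        ⟨Fin.rev ⟨m, hm'⟩, ?_, rfl⟩, ?_⟩
      · rw [← Fin.rev_lt_rev, Fin.rev_rev]
        exact hm
      · rw [Fin.rev_rev]
        exact Finset.inter_subset_right
    have := Finset.card_le_card (hA.2 hmem hle)
    have h2' : k ≤ (l.get j.rev ∩ l.get ⟨m, hm'⟩).card + 1 := h2
    lia

/-- If `N` was a facet, `insert v N` takes its place in the list; as `v` lies in no other member,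
intersections of distinct members do not change. Otherwise `insert v N` goes to the head, where it
meets every other member inside `N`, hence inside a facet `D` containing `N`. -/
theorem CliqueBuild.exists_isScalingList [Finite V] {C W : Finset V} (h : CliqueBuild H C W) :
    ∃ l : List (Finset V), IsScalingList C.card l ∧ l.Nodup ∧
      ∀ A, (H.cliqueComplexIn W).IsFacet A ↔ A ∈ l := by
  induction h with
  | base hC =>
    refine ⟨[C], ⟨trivial, by simp⟩, by simp, fun A => ?_⟩
    rw [cliqueComplexIn_of_isClique hC, SComplex.isFacet_simplex_iff, List.mem_singleton]
  | add W N v hv hNW hN hadj hcard hCN h ih =>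
    obtain ⟨l, hl, hnd, hmem⟩ := ih
    have hfacet := fun A => isFacet_cliqueComplexIn_insert hv hNW hN hadj (A := A)
    have hvl : ∀ A ∈ l, v ∉ A := fun A hA hvA => hv (((hmem A).2 hA).1.1 hvA)
    by_cases hNl : N ∈ l
    · let φ : Finset V → Finset V := fun F => if F = N then insert v N else F
      have hφN : φ N = insert v N := if_pos rfl
      have hφ : ∀ F, F ≠ N → φ F = F := fun F hF => if_neg hF
      have hsub : ∀ F, F ⊆ φ F := by
        intro F
        by_cases hF : F = N
        · rw [hF, hφN]
          exact Finset.subset_insert _ _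
        · rw [hφ F hF]
      have hinter : ∀ F B, v ∉ F → v ∉ B → F ≠ B → φ F ∩ φ B = F ∩ B := by
        intro F B hF hB hFB
        by_cases hFN : F = N
        · rw [hφ B (fun h => hFB (hFN.trans h.symm)), hFN, hφN, Finset.insert_inter_of_notMem hB]
        · by_cases hBN : B = N
          · rw [hφ F hFN, hBN, hφN, Finset.inter_insert_of_notMem hF]
          · rw [hφ F hFN, hφ B hBN]
      refine ⟨l.map φ, ?_, ?_, fun A => ?_⟩
      · have key : ∀ l : List (Finset V), (∀ A ∈ l, v ∉ A) → l.Nodup → IsScalingList C.card l →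
            IsScalingList C.card (l.map φ) := by
          intro l hvl hnd hl
          induction l with
          | nil => trivial
          | cons F l ih =>
            obtain ⟨hFl, hnd⟩ := List.nodup_cons.1 hnd
            refine ⟨ih (fun A hA => hvl A (by simp [hA])) hnd hl.1, fun B hB => ?_⟩
            obtain ⟨B, hBl, rfl⟩ := List.mem_map.1 hB
            obtain ⟨D, hD, h1, h2⟩ := hl.2 B hBl
            refine ⟨φ D, List.mem_map_of_mem hD, ?_, h2.trans (Nat.add_le_add_right
              (Finset.card_le_card (Finset.inter_subset_inter (hsub F) (hsub D))) 1)⟩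
            rw [hinter F B (hvl F (by simp)) (hvl B (by simp [hBl])) fun h => hFl (h ▸ hBl)]
            exact h1.trans (hsub D)
        exact key l hvl hnd hl
      · refine hnd.map_on fun F hF B hB hFB => ?_
        by_contra hne
        have h1 := hinter F B (hvl F hF) (hvl B hB) hne
        rw [← hFB, Finset.inter_self] at h1
        have hF' : F ⊆ B := (hsub F).trans (h1.le.trans Finset.inter_subset_right)
        have hB' : B ⊆ F := (hsub B).trans (hFB ▸ h1.le.trans Finset.inter_subset_left)
        exact hne (hF'.antisymm hB')
      · rw [hfacet, List.mem_map]
        constructor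
        · rintro (rfl | ⟨hA, hAN⟩)
          · exact ⟨N, hNl, hφN⟩
          · exact ⟨A, (hmem A).1 hA, hφ A hAN⟩
        · rintro ⟨F, hF, rfl⟩
          by_cases hFN : F = N
          · exact .inl (by rw [hFN, hφN])
          · rw [hφ F hFN]
            exact .inr ⟨(hmem F).2 hF, hFN⟩
    · obtain ⟨D, hD, hND⟩ := SComplex.exists_isFacet_ge (Δ := H.cliqueComplexIn W)
        (F := N) ⟨hNW, hN⟩
      refine ⟨insert v N :: l, ⟨hl, fun B hB => ⟨D, (hmem D).1 hD, ?_, ?_⟩⟩,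
        List.nodup_cons.2 ⟨fun h => hvl _ h (Finset.mem_insert_self _ _), hnd⟩, fun A => ?_⟩
      · rw [Finset.insert_inter_of_notMem (hvl B hB)]
        exact Finset.inter_subset_left.trans hND
      · refine hcard.trans (Nat.add_le_add_right (Finset.card_le_card ?_) 1)
        exact Finset.subset_inter (Finset.subset_insert _ _) hND
      · rw [hfacet, List.mem_cons, hmem]
        refine or_congr_right ⟨fun h => h.1, fun h => ⟨h, ?_⟩⟩
        rintro rfl
        exact hNl h

theorem CliqueBuild.scalable [Finite V] {C W : Finset V} (h : CliqueBuild H C W) :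
    (H.cliqueComplexIn W).Scalable := by
  obtain ⟨l, hl, hnd, hmem⟩ := h.exists_isScalingList
  exact hl.scalable hnd hmem h.mdim_eq

theorem CliqueBuild.isInitiallyCohenMacaulay [Fintype V] {C W : Finset V}
    (h : CliqueBuild H C W) (K : Type*) [Field K] :
    (H.cliqueComplexIn W).IsInitiallyCohenMacaulay K := by
  have hmem := fun A => SComplex.mem_pureSkeleton_mdim_iff h.isFacet.2 h.mdim_eq (A := A)
  refine h.pureShellable.isCohenMacaulay (fun A hA => ((hmem A).1 hA).2) ((hmem ∅).2 ?_)
  exact ⟨⟨by simp, by simp⟩, by simp⟩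

theorem ChordalGraph.exists_cliqueBuild [Fintype V] (hH : H.ChordalGraph)
    (h : (H.cliqueComplexIn Finset.univ).WeaklyConnected) :
    ∃ C, CliqueBuild H C Finset.univ := by
  obtain ⟨C, hC, hmin, hmd⟩ := SComplex.exists_isFacet_card_eq
    (Δ := H.cliqueComplexIn Finset.univ) (F := ∅) ⟨by simp, by simp⟩
  refine ⟨C, hH.cliqueBuild C Finset.univ hC hmin fun A B hA hB => ?_⟩
  refine reflTransGen_map id (fun F F' ⟨h1, h2, h3⟩ => .single ⟨h1, h2, ?_⟩) (h A B hA hB)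
  rw [hmd] at h3
  simp only [id]
  lia

end SimpleGraph

theorem theorem5p3 {V : Type*} [Fintype V] [DecidableEq V] (G : SimpleGraph V)
    (hG : G.CoChordal) (K : Type*) [Field K] :
    [G.indepComplex.WeaklyConnected,
      G.indepComplex.VertexDismissible,
      G.indepComplex.Scalable,
      G.indepComplex.IsInitiallyCohenMacaulay K].TFAE := by
  rw [G.indepComplex_eq_cliqueComplexIn]
  tfae_have 2 → 1 := fun h => h.weaklyConnected
  tfae_have 3 → 1 := fun h => h.weaklyConnected
  tfae_have 4 → 1 := fun h => h.weaklyConnected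
  tfae_have 1 → 2 := fun h => (hG.exists_cliqueBuild h).elim fun _ h => h.vertexDismissible
  tfae_have 1 → 3 := fun h => (hG.exists_cliqueBuild h).elim fun _ h => h.scalable
  tfae_have 1 → 4 := fun h =>
    (hG.exists_cliqueBuild h).elim fun _ h => h.isInitiallyCohenMacaulay K
  tfae_finish
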